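/- For positive integers $a,b$ let $R(a,b)$ denote the Ramsey number, i.e. the smallest positive integer $n$ such that every graph on $n$ vertices contains a clique of size $a$ or an independent set of size $b$. Let $\tau(x)=6x^5-15x^4+10x^3$. For real $r\ge 5$ and $\varepsilon\in(0,1/2)$ define $\rho_{r,\varepsilon}\colon[0,\infty)\to[0,\infty)$ by \[ \rho_{r,\varepsilon}(x)=\begin{cases}0 & \text{if } 0\le x\le\varepsilon,\\ \dfrac{r-4}{4}\,\tau\!\left(\dfrac{x-\varepsilon}{1-\varepsilon}\right) & \text{if } \varepsilon\le x\le 1,\\ \rho_{r,\varepsilon}(1/x) & \text{if } x\ge 1.\end{cases} \] Theorem. For every $\varepsilon\in(0,1/2)$ there is a constant $C_\varepsilon>0$, depending only on $\varepsilon$, such that for every real $r\ge 5$ and all integers $k\ge 1$ and $\ell\ge 0$, \[ R(k+1,\ell+1)\le 2^{C_\varepsilon r^2}\,\exp\!\bigl(-\rho_{r,\varepsilon}(\ell/k)\,\log(k+\ell)\bigr)\binom{k+\ell}{k}. \] -/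

import Mathlib

/-- Every graph on `n` vertices contains a clique of size `k` or an independent set of size `l`. -/
def IsRamsey (k l n : ℕ) : Prop :=
  ∀ G : SimpleGraph (Fin n),
    (∃ s : Finset (Fin n), G.IsNClique k s) ∨ (∃ s : Finset (Fin n), G.IsNIndepSet l s)

/-- The Ramsey number `R(k, l)`: the smallest positive integer `n` such that every graph on
`n` vertices contains a clique of size `k` or an independent set of size `l`. The set is never
empty (see `ramseyNumber_isLeast`), so the infimum is its least element. -/
noncomputable def ramseyNumber (k l : ℕ) : ℕ :=
  sInf {n : ℕ | 0 < n ∧ IsRamsey k l n}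

/-- Erdős–Szekeres argument inside a finite set of vertices. -/
theorem exists_isNClique_or_isNIndepSet (k : ℕ) : ∀ l : ℕ, ∃ N : ℕ,
    ∀ (V : Type) (G : SimpleGraph V) (S : Finset V), N ≤ S.card →
      (∃ s : Finset V, s ⊆ S ∧ G.IsNClique k s) ∨
        (∃ s : Finset V, s ⊆ S ∧ G.IsNIndepSet l s) := by
  classical
  induction k with
  | zero =>
    intro l
    exact ⟨0, fun V G S _ => Or.inl ⟨∅, by simp, by simp [SimpleGraph.isNClique_iff]⟩⟩
  | succ k ihk =>
    intro l
    induction l with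
    | zero =>
      exact ⟨0, fun V G S _ => Or.inr ⟨∅, by simp, by simp [SimpleGraph.isNIndepSet_iff]⟩⟩
    | succ l ihl =>
      obtain ⟨A, hA⟩ := ihk (l + 1)
      obtain ⟨B, hB⟩ := ihl
      refine ⟨A + B + 1, fun V G S hS => ?_⟩
      obtain ⟨v, hv⟩ : S.Nonempty := Finset.card_pos.mp (by omega)
      have hcard : ((S.erase v).filter (fun w => G.Adj v w)).card +
          ((S.erase v).filter (fun w => ¬ G.Adj v w)).card = (S.erase v).card :=
        Finset.card_filter_add_card_filter_not _
      rw [Finset.card_erase_of_mem hv] at hcard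
      by_cases hle : A ≤ ((S.erase v).filter (fun w => G.Adj v w)).card
      · rcases hA V G _ hle with ⟨s, hs, hc⟩ | ⟨s, hs, hc⟩
        · refine Or.inl ⟨insert v s, ?_, ?_⟩
          · intro x hx
            rcases Finset.mem_insert.mp hx with rfl | hx
            · exact hv
            · exact Finset.mem_of_mem_erase (Finset.mem_of_mem_filter _ (hs hx))
          · exact hc.insert fun b hb => (Finset.mem_filter.mp (hs hb)).2
        · exact Or.inr ⟨s, fun x hx =>
            Finset.mem_of_mem_erase (Finset.mem_of_mem_filter _ (hs hx)), hc⟩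
      · have hle' : B ≤ ((S.erase v).filter (fun w => ¬ G.Adj v w)).card := by omega
        rcases hB V G _ hle' with ⟨s, hs, hc⟩ | ⟨s, hs, hc⟩
        · exact Or.inl ⟨s, fun x hx =>
            Finset.mem_of_mem_erase (Finset.mem_of_mem_filter _ (hs hx)), hc⟩
        · refine Or.inr ⟨insert v s, ?_, ?_⟩
          · intro x hx
            rcases Finset.mem_insert.mp hx with rfl | hx
            · exact hv
            · exact Finset.mem_of_mem_erase (Finset.mem_of_mem_filter _ (hs hx))
          · rw [← SimpleGraph.isNClique_compl] at hc ⊢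
            refine hc.insert fun b hb => ?_
            have hb' := Finset.mem_filter.mp (hs hb)
            exact (SimpleGraph.compl_adj _ _ _).mpr
              ⟨fun h => (Finset.mem_erase.mp hb'.1).1 h.symm, hb'.2⟩

/-- The Ramsey number is attained (in particular it exists). -/
theorem ramseyNumber_isLeast (k l : ℕ) :
    IsLeast {n : ℕ | 0 < n ∧ IsRamsey k l n} (ramseyNumber k l) := by
  have hne : {n : ℕ | 0 < n ∧ IsRamsey k l n}.Nonempty := by
    obtain ⟨N, hN⟩ := exists_isNClique_or_isNIndepSet k l
    refine ⟨N + 1, Nat.succ_pos N, fun G => ?_⟩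
    rcases hN _ G Finset.univ (by simp) with ⟨s, -, h⟩ | ⟨s, -, h⟩
    · exact Or.inl ⟨s, h⟩
    · exact Or.inr ⟨s, h⟩
  exact ⟨Nat.sInf_mem hne, fun n hn => Nat.sInf_le hn⟩

/-- The quintic `τ(x) = 6x⁵ - 15x⁴ + 10x³`. -/
def ramseyTau (x : ℝ) : ℝ := 6 * x ^ 5 - 15 * x ^ 4 + 10 * x ^ 3

/-- The values on `[0, 1]` of the function `ρ_{r,ε}`: zero on `[0, ε]` and
`(r - 4) τ((x - ε) / (1 - ε)) / 4` on `[ε, 1]`. -/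
noncomputable def ramseyRhoUnit (r ε x : ℝ) : ℝ :=
  if x ≤ ε then 0 else (r - 4) * ramseyTau ((x - ε) / (1 - ε)) / 4

/-- The function `ρ_{r,ε}` on `[0, ∞)`, extended from `[0, 1]` by `ρ_{r,ε}(x) = ρ_{r,ε}(1 / x)`
for `x ≥ 1`. -/
noncomputable def ramseyRho (r ε x : ℝ) : ℝ :=
  if x ≤ 1 then ramseyRhoUnit r ε x else ramseyRhoUnit r ε (1 / x)

/-- `φ_{r,ε}(k, l) = ρ_{r,ε}(l / k) log(k + l)`. -/
noncomputable def ramseyPhi (r ε k l : ℝ) : ℝ :=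
  ramseyRho r ε (l / k) * Real.log (k + l)

-- The Erdős–Szekeres bound can be improved by a factor exponential in `k + ℓ` as long as `ℓ / k`
-- stays away from `0` and infinity, and this implies the theorem. Indeed `ρ` vanishes unless both
-- ratios exceed `ε`; otherwise `ρ log (k + ℓ)` is at most `(r / 4) log (k + ℓ)`, which AM-GM and
-- `log² x ≤ 4x` bound by a multiple of `r²` plus a small multiple of `k + ℓ`.
--
-- The exponential improvement (`exists_gain`) is proved by induction on `m = a true + a false`. If
-- the required cliques are missing, induction inside neighbourhoods bounds the degree density in
-- colour `c` by about `a c / m`. As this holds for both colours, all densities are close to `a c /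
-- m`. Then `exists_book` yields a monochromatic book with a spine of `t ≈ γ m` vertices and almost
-- `(a c / m) ^ t` of all vertices as pages. Removing `t` from `a c` shrinks the binomial by more
-- than `(a c / m) ^ t`, with a quadratic saving in the exponent (`log_choose_sub_le`). The saving
-- exceeds both the loss in the book and the claimed gain, so Erdős–Szekeres inside the pages
-- finishes.
--
-- Books are built from a reservoir `X` and page sets `Y c`. The centred codegree kernels of the two
-- colours are Gram kernels, so all their mixed moments are nonnegative, and `exists_correlated`
-- finds a `j` and many pairs on which one kernel is at least `j² - 6` and the other at least `-6`.
-- Small `j` lets a vertex join a spine at little loss of density; large `j` raises the density of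
-- one colour. `bookPotential` accounts for both kinds of step.

universe u

/-! ### Correlation of two functions with nonnegative mixed moments. -/

/-- The entire function `∑ xⁿ / (2n)!`, equal to `cosh √x` for `x ≥ 0` and to `cos √(-x)` for
`x ≤ 0`. -/
noncomputable def coshSqrt (x : ℝ) : ℝ := ∑' n : ℕ, x ^ n / (2 * n).factorial

theorem hasSum_cosh_sqrt {x : ℝ} (hx : 0 ≤ x) :
    HasSum (fun n : ℕ => x ^ n / (2 * n).factorial) (Real.cosh (Real.sqrt x)) := by
  have h := Real.hasSum_cosh (Real.sqrt x)
  simpa only [pow_mul, Real.sq_sqrt hx] using h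

theorem hasSum_cos_sqrt {x : ℝ} (hx : x ≤ 0) :
    HasSum (fun n : ℕ => x ^ n / (2 * n).factorial) (Real.cos (Real.sqrt (-x))) := by
  have h := Real.hasSum_cos (Real.sqrt (-x))
  convert h using 2 with n
  rw [pow_mul, Real.sq_sqrt (by linarith), ← mul_pow]
  ring_nf

theorem hasSum_coshSqrt (x : ℝ) :
    HasSum (fun n : ℕ => x ^ n / (2 * n).factorial) (coshSqrt x) := by
  rcases le_total 0 x with hx | hx
  · exact (hasSum_cosh_sqrt hx).summable.hasSum
  · exact (hasSum_cos_sqrt hx).summable.hasSum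

theorem coshSqrt_of_nonneg {x : ℝ} (hx : 0 ≤ x) : coshSqrt x = Real.cosh (Real.sqrt x) :=
  (hasSum_cosh_sqrt hx).tsum_eq

theorem coshSqrt_of_nonpos {x : ℝ} (hx : x ≤ 0) : coshSqrt x = Real.cos (Real.sqrt (-x)) :=
  (hasSum_cos_sqrt hx).tsum_eq

theorem coshSqrt_le_one {x : ℝ} (hx : x ≤ 0) : coshSqrt x ≤ 1 := by
  rw [coshSqrt_of_nonpos hx]; exact Real.cos_le_one _

theorem one_add_half_le_coshSqrt {x : ℝ} (hx : 0 ≤ x) : 1 + x / 2 ≤ coshSqrt x := by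
  rw [coshSqrt]
  have h := (hasSum_coshSqrt x).summable.sum_le_tsum (Finset.range 2)
    (fun n _ => by positivity)
  simpa [Finset.sum_range_succ] using h

theorem neg_one_le_coshSqrt (x : ℝ) : -1 ≤ coshSqrt x := by
  rcases le_total 0 x with hx | hx
  · linarith [one_add_half_le_coshSqrt hx]
  · rw [coshSqrt_of_nonpos hx]; exact Real.neg_one_le_cos _

theorem coshSqrt_le_exp {x s : ℝ} (hs : 0 ≤ s) (hx : x ≤ s ^ 2) : coshSqrt x ≤ Real.exp s := by
  rcases le_total 0 x with h0 | h0
  · rw [coshSqrt_of_nonneg h0]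
    have h1 : Real.sqrt x ≤ s := Real.sqrt_le_iff.mpr ⟨hs, hx⟩
    have h2 : Real.cosh (Real.sqrt x) ≤ Real.exp (Real.sqrt x) := by
      rw [Real.cosh_eq]
      have := Real.exp_le_exp.mpr (show -Real.sqrt x ≤ Real.sqrt x by
        linarith [Real.sqrt_nonneg x])
      linarith
    exact h2.trans (Real.exp_le_exp.mpr h1)
  · exact (coshSqrt_le_one h0).trans (Real.one_le_exp hs)

/-- The test function for the correlation of two kernels. -/
noncomputable def corrTest (x y : ℝ) : ℝ := x * (2 + coshSqrt y) + y * (2 + coshSqrt x)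

theorem corrTest_comm (x y : ℝ) : corrTest x y = corrTest y x := by
  unfold corrTest; ring

/-- For `y ≥ 0`, `coshSqrt y ≥ 1 + y / 2` makes the first summand at most `-18 - 3 * y`, which beats
`y * (2 + coshSqrt x) ≤ 3 * y`; this is where `-6` comes from. For `y ≤ 0` the first summand is
below `-6` and the second is nonpositive. -/
theorem corrTest_le_neg_one {x y : ℝ} (hx : x < -6) : corrTest x y ≤ -1 := by
  unfold corrTest
  have h1 := coshSqrt_le_one (show x ≤ 0 by linarith)
  have h2 := neg_one_le_coshSqrt x
  rcases le_total 0 y with hy | hy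
  · have h3 := one_add_half_le_coshSqrt hy
    nlinarith
  · have h3 := neg_one_le_coshSqrt y
    nlinarith

theorem corrTest_le_exp {x y s : ℝ} (hs : 0 ≤ s) (hx : x ≤ s ^ 2) (hy : y ≤ s ^ 2) :
    corrTest x y ≤ 12 * Real.exp (2 * s) := by
  have h1 := coshSqrt_le_exp hs hx
  have h2 := coshSqrt_le_exp hs hy
  have h3 := neg_one_le_coshSqrt x
  have h4 := neg_one_le_coshSqrt y
  have h5 : 1 ≤ Real.exp s := Real.one_le_exp hs
  have h6 : s ^ 2 ≤ 2 * Real.exp s := by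
    have := Real.quadratic_le_exp_of_nonneg hs
    nlinarith
  have key : ∀ a c : ℝ, a ≤ s ^ 2 → -1 ≤ c → c ≤ Real.exp s →
      a * (2 + c) ≤ 6 * (Real.exp s * Real.exp s) := by
    intro a c ha hc hc'
    calc a * (2 + c) ≤ s ^ 2 * (2 + c) := by
          apply mul_le_mul_of_nonneg_right ha; linarith
      _ ≤ s ^ 2 * (3 * Real.exp s) := by
          apply mul_le_mul_of_nonneg_left _ (sq_nonneg s); linarith
      _ ≤ (2 * Real.exp s) * (3 * Real.exp s) := by
          apply mul_le_mul_of_nonneg_right h6; positivity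
      _ = _ := by ring
  have hexp : Real.exp (2 * s) = Real.exp s * Real.exp s := by
    rw [← Real.exp_add]; ring_nf
  unfold corrTest
  rw [hexp]
  linarith [key x _ hx h4 h2, key y _ hy h3 h1]

/-- The reason for the shape of `corrTest`: its power series has nonnegative coefficients, so its
sum is a nonnegative combination of mixed moments. -/
theorem sum_corrTest_nonneg {ι : Type*} (P : Finset ι) (z w : ι → ℝ)
    (h : ∀ a b : ℕ, 0 ≤ ∑ i ∈ P, z i ^ a * w i ^ b) : 0 ≤ ∑ i ∈ P, corrTest (z i) (w i) := by
  have half : ∀ u v : ι → ℝ, (∀ a b : ℕ, 0 ≤ ∑ i ∈ P, u i ^ a * v i ^ b) →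
      0 ≤ ∑ i ∈ P, u i * (2 + coshSqrt (v i)) := by
    intro u v huv
    have h1 : HasSum (fun n : ℕ => ∑ i ∈ P, u i * (v i ^ n / (2 * n).factorial))
        (∑ i ∈ P, u i * coshSqrt (v i)) :=
      hasSum_sum fun i _ => (hasSum_coshSqrt (v i)).mul_left (u i)
    have h2 : 0 ≤ ∑ i ∈ P, u i * coshSqrt (v i) := by
      refine h1.nonneg fun n => ?_
      have h3 : ∑ i ∈ P, u i * (v i ^ n / (2 * n).factorial)
          = (∑ i ∈ P, u i ^ 1 * v i ^ n) / (2 * n).factorial := by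
        rw [Finset.sum_div]
        exact Finset.sum_congr rfl fun i _ => by rw [pow_one, mul_div_assoc]
      simp only [h3]
      exact div_nonneg (huv 1 n) (by positivity)
    have h4 := huv 1 0
    simp only [pow_one, pow_zero, mul_one] at h4
    simp only [mul_add, Finset.sum_add_distrib, ← Finset.sum_mul]
    linarith
  simp only [corrTest, Finset.sum_add_distrib]
  refine add_nonneg (half z w h) (half w z fun a b => ?_)
  simpa only [mul_comm] using h b a

open Finset in
/-- If all mixed moments of `z` and `w` are nonnegative, then for some `j` the function `z` or `w`
is at least `j² - 6` on a proportion `e^{-3j} / 1000` of the points, on which the other one is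
not very negative. -/
theorem exists_correlated {ι : Type*} (P : Finset ι) (hP : P.Nonempty) (z w : ι → ℝ)
    (h : ∀ a b : ℕ, 0 ≤ ∑ i ∈ P, z i ^ a * w i ^ b) :
    ∃ j : ℕ,
      (Real.exp (-(3 * j)) / 1000 * #P ≤ #{i ∈ P | (j : ℝ) ^ 2 - 6 ≤ z i ∧ -6 ≤ w i}) ∨
      (Real.exp (-(3 * j)) / 1000 * #P ≤ #{i ∈ P | (j : ℝ) ^ 2 - 6 ≤ w i ∧ -6 ≤ z i}) := by
  classical
  -- If every `j` fails, the sum of `corrTest` over `E` is at most `n / 2`, while each of the at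
  -- least `n - n / 500` terms off `E` is at most `-1`; the total would be negative.
  by_contra! hcon
  set E : Finset ι := {i ∈ P | -6 ≤ z i ∧ -6 ≤ w i} with hE
  set s : ι → ℝ := fun i => Real.sqrt (max (z i) (w i) + 6) with hs
  set J : ι → ℕ := fun i => ⌊s i⌋₊ with hJ
  set n : ℝ := (#P : ℝ) with hn
  have hnpos : 0 < n := by simpa [hn] using hP
  have tail : ∀ j : ℕ, (#{i ∈ E | j ≤ J i} : ℝ) ≤ Real.exp (-(3 * j)) / 500 * n := by
    intro j
    have hsub : {i ∈ E | j ≤ J i} ⊆ {i ∈ P | (j : ℝ) ^ 2 - 6 ≤ z i ∧ -6 ≤ w i} ∪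
        {i ∈ P | (j : ℝ) ^ 2 - 6 ≤ w i ∧ -6 ≤ z i} := by
      intro i hi
      simp only [hE, mem_filter, mem_union] at hi ⊢
      obtain ⟨⟨hiP, hz, hw⟩, hj⟩ := hi
      have h1 : (j : ℝ) ≤ s i := (Nat.le_floor_iff (Real.sqrt_nonneg _)).mp hj
      have h2 : (j : ℝ) ^ 2 ≤ max (z i) (w i) + 6 :=
        (Real.le_sqrt (Nat.cast_nonneg j) (by linarith [le_max_left (z i) (w i)])).mp h1
      rcases le_total (z i) (w i) with h3 | h3
      · right; rw [max_eq_right h3] at h2; exact ⟨hiP, by linarith, hz⟩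
      · left; rw [max_eq_left h3] at h2; exact ⟨hiP, by linarith, hw⟩
    have h1 : (#{i ∈ E | j ≤ J i} : ℝ) ≤ #{i ∈ P | (j : ℝ) ^ 2 - 6 ≤ z i ∧ -6 ≤ w i} +
        #{i ∈ P | (j : ℝ) ^ 2 - 6 ≤ w i ∧ -6 ≤ z i} := by
      exact_mod_cast (card_le_card hsub).trans (card_union_le _ _)
    have := hcon j
    linarith [this.1, this.2]
  have hEcard : (#E : ℝ) ≤ n / 500 := by
    have := tail 0
    simp at this
    linarith
  have hpoint : ∀ i ∈ E, corrTest (z i) (w i) ≤ 12 * Real.exp (2 * (J i + 1)) := by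
    intro i hi
    simp only [hE, mem_filter] at hi
    have h1 : s i ≤ J i + 1 := (Nat.lt_floor_add_one _).le
    have h2 : s i ^ 2 = max (z i) (w i) + 6 := by
      rw [hs]; apply Real.sq_sqrt
      linarith [le_max_left (z i) (w i), hi.2.1]
    have h0 : 0 ≤ s i := Real.sqrt_nonneg _
    refine (corrTest_le_exp h0 ?_ ?_).trans ?_
    · linarith [le_max_left (z i) (w i)]
    · linarith [le_max_right (z i) (w i)]
    · gcongr
  have hsumE : ∑ i ∈ E, corrTest (z i) (w i) ≤ n / 2 := by
    set m := E.sup J with hm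
    have h1 : ∑ i ∈ E, corrTest (z i) (w i) ≤
        ∑ j ∈ range (m + 1), ∑ i ∈ E with J i = j, 12 * Real.exp (2 * (J i + 1)) := by
      rw [sum_fiberwise_of_maps_to]
      · exact sum_le_sum hpoint
      · intro i hi
        simpa [Nat.lt_succ_iff] using le_sup (f := J) hi
    -- The tail `exp (-3j)` against the growth `exp (2j)` leaves a geometric series of ratio `exp
    -- (-1)`.
    have h2 : ∀ j ∈ range (m + 1),
        ∑ i ∈ E with J i = j, 12 * Real.exp (2 * (J i + 1)) ≤
          (12 * Real.exp 2 / 500 * n) * Real.exp (-1) ^ j := by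
      intro j _
      have h3 : ∑ i ∈ E with J i = j, 12 * Real.exp (2 * ((J i : ℝ) + 1)) =
          #{i ∈ E | J i = j} * (12 * Real.exp (2 * ((j : ℝ) + 1))) := by
        rw [← nsmul_eq_mul, ← sum_const]
        refine sum_congr rfl fun i hi => ?_
        rw [(mem_filter.mp hi).2]
      have h4 : (#{i ∈ E | J i = j} : ℝ) ≤ Real.exp (-(3 * j)) / 500 * n := by
        refine le_trans ?_ (tail j)
        exact_mod_cast card_le_card (fun i hi => by
          simp only [mem_filter] at hi ⊢; exact ⟨hi.1, hi.2.ge⟩)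
      rw [h3]
      calc _ ≤ (Real.exp (-(3 * j)) / 500 * n) * (12 * Real.exp (2 * ((j : ℝ) + 1))) := by
            gcongr
        _ = (12 * (Real.exp (-(3 * j)) * Real.exp (2 * ((j : ℝ) + 1))) / 500 * n) := by ring
        _ = _ := by
            rw [← Real.exp_add, ← Real.exp_nat_mul,
              show -(3 * (j : ℝ)) + 2 * (j + 1) = 2 + j * (-1) by ring, Real.exp_add]
            ring
    have he1 : Real.exp (-1) ≤ 1 / 2 := by
      rw [Real.exp_neg, one_div]
      exact inv_anti₀ (by norm_num) (by linarith [Real.exp_one_gt_d9])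
    have he2 : Real.exp 2 ≤ 7.5 := by
      have : Real.exp 2 = Real.exp 1 * Real.exp 1 := by rw [← Real.exp_add]; norm_num
      rw [this]
      nlinarith [Real.exp_one_lt_d9, Real.exp_pos 1]
    have hgeom : ∑ j ∈ range (m + 1), Real.exp (-1) ^ j ≤ 2 := by
      have h5 : ∑ j ∈ range (m + 1), Real.exp (-1) ^ j ≤ ∑ j ∈ range (m + 1), (1 / 2 : ℝ) ^ j :=
        sum_le_sum fun j _ => by gcongr
      exact h5.trans (sum_geometric_two_le _)
    calc _ ≤ _ := h1
      _ ≤ ∑ j ∈ range (m + 1), (12 * Real.exp 2 / 500 * n) * Real.exp (-1) ^ j := sum_le_sum h2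
      _ = (12 * Real.exp 2 / 500 * n) * ∑ j ∈ range (m + 1), Real.exp (-1) ^ j := by
          rw [mul_sum]
      _ ≤ (12 * Real.exp 2 / 500 * n) * 2 := by gcongr
      _ ≤ n / 2 := by nlinarith
  have hsumC : ∑ i ∈ P \ E, corrTest (z i) (w i) ≤ -(n - #E) := by
    have h1 : ∀ i ∈ P \ E, corrTest (z i) (w i) ≤ -1 := by
      intro i hi
      simp only [hE, mem_sdiff, mem_filter, not_and, not_le] at hi
      by_cases hz : -6 ≤ z i
      · rw [corrTest_comm]; exact corrTest_le_neg_one (hi.2 hi.1 hz)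
      · exact corrTest_le_neg_one (not_le.mp hz)
    refine (sum_le_card_nsmul _ _ _ h1).trans ?_
    rw [nsmul_eq_mul, cast_card_sdiff (filter_subset _ _)]
    linarith
  have htot := sum_corrTest_nonneg P z w h
  rw [← sum_sdiff (show E ⊆ P from filter_subset _ _)] at htot
  linarith

/-! ### Gram kernels and a single step of the book algorithm. -/

/-- A kernel which is the Gram kernel of finitely many functions. -/
def IsGramKernel {V : Type u} (K : V → V → ℝ) : Prop :=
  ∃ (ι : Type u) (_ : Fintype ι) (f : ι → V → ℝ), ∀ x y, K x y = ∑ i, f i x * f i y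

namespace IsGramKernel

variable {V : Type u} {K L : V → V → ℝ}

theorem one : IsGramKernel (fun _ _ : V => (1 : ℝ)) :=
  ⟨PUnit, inferInstance, fun _ _ => 1, by simp⟩

theorem mul (hK : IsGramKernel K) (hL : IsGramKernel L) :
    IsGramKernel (fun x y => K x y * L x y) := by
  obtain ⟨ι, _, f, hf⟩ := hK
  obtain ⟨κ, _, g, hg⟩ := hL
  refine ⟨ι × κ, inferInstance, fun i x => f i.1 x * g i.2 x, fun x y => ?_⟩
  beta_reduce
  rw [hf, hg, Finset.sum_mul_sum, Fintype.sum_prod_type]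
  exact Finset.sum_congr rfl fun i _ => Finset.sum_congr rfl fun j _ => by ring

theorem pow (hK : IsGramKernel K) (n : ℕ) : IsGramKernel (fun x y => K x y ^ n) := by
  induction n with
  | zero => simpa using one
  | succ n ih => simpa only [pow_succ] using ih.mul hK

theorem sum_nonneg (hK : IsGramKernel K) (X : Finset V) :
    0 ≤ ∑ q ∈ X ×ˢ X, K q.1 q.2 := by
  obtain ⟨ι, _, f, hf⟩ := hK
  simp only [hf]
  rw [Finset.sum_comm]
  refine Finset.sum_nonneg fun i _ => ?_
  rw [Finset.sum_product, ← Finset.sum_mul_sum]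
  exact mul_self_nonneg _

/-- The centred intersection kernel of a family of `d`-element subsets of `Y`. -/
theorem inter [DecidableEq V] (A : V → Finset V) (Y : Finset V) (d : ℕ) (hY : Y.Nonempty)
    (hA : ∀ x, A x ⊆ Y) (hd : ∀ x, (A x).card = d) {c : ℝ} (hc : 0 < c) :
    IsGramKernel (fun x y => ((A x ∩ A y).card - (d : ℝ) ^ 2 / Y.card) / c) := by
  classical
  have hY0 : (Y.card : ℝ) ≠ 0 := by exact_mod_cast hY.card_pos.ne'
  -- One function per point `v ∈ Y`: the indicator of `v ∈ A x` minus the density `d / |Y|`, so that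
  -- the cross terms collapse to `-d² / |Y|`.
  refine ⟨Y, inferInstance,
    fun v x => ((if (v : V) ∈ A x then 1 else 0) - (d : ℝ) / Y.card) / Real.sqrt c,
    fun x y => ?_⟩
  have h1 : ∀ x, ∑ v ∈ Y, (if v ∈ A x then (1 : ℝ) else 0) = d := fun x => by
    rw [Finset.sum_ite_mem, Finset.inter_eq_right.mpr (hA x)]
    simp [hd]
  have h2 : ∑ v ∈ Y, (if v ∈ A x then (1 : ℝ) else 0) * (if v ∈ A y then 1 else 0)
      = (A x ∩ A y).card := by
    have h : ∀ v, (if v ∈ A x then (1 : ℝ) else 0) * (if v ∈ A y then 1 else 0) =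
        if v ∈ A x ∩ A y then 1 else 0 := fun v => by
      by_cases h1 : v ∈ A x <;> by_cases h2 : v ∈ A y <;> simp [h1, h2]
    simp only [h]
    rw [Finset.sum_ite_mem, Finset.inter_eq_right.mpr
      (Finset.inter_subset_left.trans (hA x))]
    simp
  have h3 : ∀ v : V, (((if v ∈ A x then (1 : ℝ) else 0) - (d : ℝ) / Y.card) / Real.sqrt c) *
      (((if v ∈ A y then (1 : ℝ) else 0) - (d : ℝ) / Y.card) / Real.sqrt c) =
      ((if v ∈ A x then (1 : ℝ) else 0) * (if v ∈ A y then 1 else 0)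
        - (d / Y.card) * (if v ∈ A x then (1 : ℝ) else 0)
        - (d / Y.card) * (if v ∈ A y then (1 : ℝ) else 0) + (d / Y.card) ^ 2) / c := fun v => by
    rw [div_mul_div_comm, Real.mul_self_sqrt hc.le]
    ring
  beta_reduce
  simp only [h3]
  rw [Finset.sum_coe_sort Y (fun v => ((if v ∈ A x then (1 : ℝ) else 0) *
    (if v ∈ A y then 1 else 0) - (d / Y.card) * (if v ∈ A x then (1 : ℝ) else 0)
    - (d / Y.card) * (if v ∈ A y then (1 : ℝ) else 0) + (d / Y.card) ^ 2) / c)]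
  rw [← Finset.sum_div, Finset.sum_add_distrib, Finset.sum_sub_distrib, Finset.sum_sub_distrib,
    ← Finset.mul_sum, ← Finset.mul_sum, h1, h1, h2, Finset.sum_const, nsmul_eq_mul]
  congr 1
  field_simp
  ring

end IsGramKernel

open Finset in
/-- Pigeonhole for pairs: a dense set of pairs has a dense fibre. -/
theorem exists_dense_fibre {V : Type u} (X : Finset V) (hX : X.Nonempty) (R : V → V → Prop)
    [∀ x y, Decidable (R x y)] {β : ℝ}
    (h : β * #(X ×ˢ X) ≤ #{q ∈ X ×ˢ X | R q.1 q.2}) :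
    ∃ x ∈ X, β * #X ≤ #{y ∈ X | R x y} := by
  classical
  by_contra! hcon
  have h1 : (#{q ∈ X ×ˢ X | R q.1 q.2} : ℝ) = ∑ x ∈ X, (#{y ∈ X | R x y} : ℝ) := by
    simp only [card_filter, Nat.cast_sum, sum_product]
  rw [h1] at h
  have h2 : ∑ x ∈ X, (#{y ∈ X | R x y} : ℝ) < ∑ x ∈ X, β * #X := sum_lt_sum_of_nonempty hX hcon
  rw [sum_const, nsmul_eq_mul] at h2
  rw [card_product] at h
  push_cast at h
  linarith

open Finset Classical in
/-- One step of the book algorithm. -/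
theorem exists_book_step {V : Type u} (H : Bool → SimpleGraph V) (X : Finset V)
    (hX : X.Nonempty) (Y : Bool → Finset V) (p α : Bool → ℝ) (hY : ∀ c, (Y c).Nonempty)
    (hp : ∀ c, 0 < p c) (hα : ∀ c, 0 < α c)
    (hdeg : ∀ c, ∀ x ∈ X, p c * #(Y c) ≤ #{v ∈ Y c | (H c).Adj x v}) :
    ∃ (j : ℕ) (i : Bool) (x : V) (X' : Finset V) (Y' : Bool → Finset V), x ∈ X ∧ X' ⊆ X ∧
      Real.exp (-(3 * j)) / 1000 * #X ≤ #X' ∧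
      (∀ c, Y' c ⊆ Y c ∧ (∀ v ∈ Y' c, (H c).Adj x v) ∧ p c * #(Y c) ≤ #(Y' c)) ∧
      (∀ y ∈ X', (p i + ((j : ℝ) ^ 2 - 6) * α i) * #(Y' i) ≤ #{v ∈ Y' i | (H i).Adj y v}) ∧
      (∀ y ∈ X', (p (!i) - 6 * α (!i)) * #(Y' (!i)) ≤ #{v ∈ Y' (!i) | (H (!i)).Adj y v}) := by
  set d : Bool → ℕ := fun c => ⌈p c * #(Y c)⌉₊ with hd
  have hYpos : ∀ c, (0 : ℝ) < #(Y c) := fun c => by exact_mod_cast (hY c).card_pos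
  have hdpos : ∀ c, (0 : ℝ) < d c := fun c => by
    exact_mod_cast Nat.ceil_pos.mpr (mul_pos (hp c) (hYpos c))
  have hple : ∀ c, p c * #(Y c) ≤ d c := fun c => Nat.le_ceil _
  have hdX : ∀ c, ∀ x ∈ X, d c ≤ #{v ∈ Y c | (H c).Adj x v} := fun c x hx =>
    Nat.ceil_le.mpr (hdeg c x hx)
  -- Neighbourhoods are trimmed to exactly `d c` elements, as `IsGramKernel.inter` requires; outside
  -- `X` a dummy set keeps the family total.
  have hA : ∀ c x, ∃ A ⊆ Y c, #A = d c ∧ (x ∈ X → ∀ v ∈ A, (H c).Adj x v) := by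
    intro c x
    by_cases hx : x ∈ X
    · obtain ⟨A, hA, hcard⟩ := exists_subset_card_eq (hdX c x hx)
      exact ⟨A, hA.trans (filter_subset _ _), hcard, fun _ v hv => (mem_filter.mp (hA hv)).2⟩
    · obtain ⟨x₀, hx₀⟩ := hX
      obtain ⟨A, hA, hcard⟩ := exists_subset_card_eq (hdX c x₀ hx₀)
      exact ⟨A, hA.trans (filter_subset _ _), hcard, fun h => absurd h hx⟩
  choose A hAY hAcard hAadj using hA
  set K : Bool → V → V → ℝ := fun c x y =>
    ((A c x ∩ A c y).card - (d c : ℝ) ^ 2 / (Y c).card) / (α c * d c) with hK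
  have hgram : ∀ c, IsGramKernel (K c) := fun c =>
    IsGramKernel.inter (A c) (Y c) (d c) (hY c) (hAY c) (hAcard c) (mul_pos (hα c) (hdpos c))
  -- A kernel value at least `s` means `|A x ∩ A y| ≥ d² / |Y| + s α d`, and `d ≥ p |Y|` turns this
  -- into density `p + s α` inside `A x`.
  have hcodeg : ∀ c, ∀ x, ∀ y ∈ X, ∀ s : ℝ, s ≤ K c x y →
      (p c + s * α c) * #(A c x) ≤ #{v ∈ A c x | (H c).Adj y v} := by
    intro c x y hy s hs
    rw [hK, le_div_iff₀ (mul_pos (hα c) (hdpos c))] at hs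
    have h1 : (#(A c x ∩ A c y) : ℝ) ≤ #{v ∈ A c x | (H c).Adj y v} := by
      exact_mod_cast card_le_card fun v hv => by
        rw [mem_inter] at hv
        exact mem_filter.mpr ⟨hv.1, hAadj c y hy v hv.2⟩
    have h2 : p c * d c ≤ (d c : ℝ) ^ 2 / (Y c).card := by
      rw [le_div_iff₀ (hYpos c), sq]
      nlinarith [hple c, hdpos c]
    rw [hAcard]
    nlinarith
  obtain ⟨j, hj⟩ := exists_correlated (X ×ˢ X) (hX.product hX)
    (fun q => K true q.1 q.2) (fun q => K false q.1 q.2)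
    (fun a b => (((hgram true).pow a).mul ((hgram false).pow b)).sum_nonneg X)
  have main : ∃ i : Bool, Real.exp (-(3 * j)) / 1000 * #(X ×ˢ X) ≤
      #{q ∈ X ×ˢ X | (j : ℝ) ^ 2 - 6 ≤ K i q.1 q.2 ∧ -6 ≤ K (!i) q.1 q.2} := by
    rcases hj with hj | hj
    · exact ⟨true, hj⟩
    · exact ⟨false, hj⟩
  obtain ⟨i, hi⟩ := main
  obtain ⟨x, hx, hx'⟩ := exists_dense_fibre X hX
    (fun x y => (j : ℝ) ^ 2 - 6 ≤ K i x y ∧ -6 ≤ K (!i) x y) hi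
  refine ⟨j, i, x, _, fun c => A c x, hx, filter_subset _ _, hx', fun c =>
    ⟨hAY c x, hAadj c x hx, ?_⟩, fun y hy => ?_, fun y hy => ?_⟩
  · rw [hAcard]; exact hple c
  · have hy := mem_filter.mp hy
    exact hcodeg i x y hy.1 _ hy.2.1
  · have hy := mem_filter.mp hy
    simpa only [neg_mul, ← sub_eq_add_neg] using hcodeg (!i) x y hy.1 _ hy.2.2

/-! ### The potential and the run of the book algorithm. -/

/-- A monochromatic book: a clique `T ⊆ X` with `s` vertices, completely joined to a set `M ⊆ Y`
of at least `m` vertices. -/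
def HasBook {V : Type u} (G : SimpleGraph V) (X Y : Finset V) (s : ℕ) (m : ℝ) : Prop :=
  ∃ T ⊆ X, ∃ M ⊆ Y, T.card = s ∧ m ≤ M.card ∧ G.IsClique (T : Set V) ∧
    ∀ a ∈ T, ∀ b ∈ M, G.Adj a b

theorem HasBook.mono {V : Type u} {G : SimpleGraph V} {X X' Y Y' : Finset V} {s : ℕ} {m : ℝ}
    (h : HasBook G X Y s m) (hX : X ⊆ X') (hY : Y ⊆ Y') : HasBook G X' Y' s m := by
  obtain ⟨T, hT, M, hM, h⟩ := h
  exact ⟨T, hT.trans hX, M, hM.trans hY, h⟩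

theorem HasBook.insert {V : Type u} {G : SimpleGraph V} {X X' Y Y' : Finset V} {s : ℕ} {m : ℝ}
    {x : V} (h : HasBook G X' Y' s m) (hx : x ∈ X) (hX : X' ⊆ X) (hY : Y' ⊆ Y)
    (hxX : ∀ v ∈ X', G.Adj x v) (hxY : ∀ v ∈ Y', G.Adj x v) : HasBook G X Y (s + 1) m := by
  classical
  obtain ⟨T, hT, M, hM, hs, hm, hcl, hj⟩ := h
  have hxT : x ∉ T := fun hxT => G.loopless.irrefl x (hxX x (hT hxT))
  refine ⟨Insert.insert x T, Finset.insert_subset hx (hT.trans hX), M, hM.trans hY, ?_, hm, ?_, ?_⟩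
  · rw [Finset.card_insert_of_notMem hxT, hs]
  · rw [Finset.coe_insert, SimpleGraph.isClique_insert]
    exact ⟨hcl, fun v hv _ => hxX v (hT hv)⟩
  · intro a ha b hb
    rcases Finset.mem_insert.mp ha with rfl | ha
    · exact hxY b (hM hb)
    · exact hj a ha b hb

/-- The potential of a state of the book algorithm in one colour, with current density `p`, floor
`r` for the density, and `s` vertices still to be found. -/
noncomputable def bookPotential (r t p : ℝ) (s : ℕ) : ℝ := Real.log (2 / (p - r)) + 12 * s / t

theorem bookPotential_nonneg {r t p : ℝ} (s : ℕ) (hr : 0 ≤ r) (ht : 0 < t) (hp : r < p)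
    (hp1 : p ≤ 1) : 0 ≤ bookPotential r t p s := by
  have : 0 ≤ Real.log (2 / (p - r)) := Real.log_nonneg (by
    rw [le_div_iff₀ (by linarith)]; linarith)
  unfold bookPotential
  positivity

/-- Density changes are proportional to `p - r`, so they multiply it by `1 + l / t` and act
additively on the potential. -/
theorem bookPotential_boost {r t p l : ℝ} (s : ℕ) (hp : r < p) (hl : 0 < 1 + l / t) :
    bookPotential r t (p + l * ((p - r) / t)) s =
      bookPotential r t p s - Real.log (1 + l / t) := by
  unfold bookPotential
  have h1 : p + l * ((p - r) / t) - r = (p - r) * (1 + l / t) := by ring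
  have h2 : 0 < p - r := by linarith
  rw [h1, ← div_div, Real.log_div (by positivity) hl.ne']
  ring

/-- Shrinking `p - r` by `1 - 6 / t` costs at most `12 / t` in the logarithm, exactly what one spine
vertex releases. Hence a colour step never raises the potential. -/
theorem bookPotential_colour {r t p : ℝ} {s : ℕ} (hp : r < p) (ht : 12 ≤ t) :
    bookPotential r t (p - 6 * ((p - r) / t)) s ≤ bookPotential r t p (s + 1) := by
  have ht0 : 0 < t := by linarith
  have h6 : 6 / t ≤ 1 / 2 := by rw [div_le_iff₀ ht0]; linarith
  have h60 : 0 < 6 / t := by positivity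
  have h := bookPotential_boost (l := -6) (t := t) s hp (by rw [neg_div]; linarith)
  rw [sub_eq_add_neg, ← neg_mul, h]
  unfold bookPotential
  have h1 : -(12 / t) ≤ Real.log (1 + -6 / t) := by
    have h2 := Real.one_sub_inv_le_log_of_pos (show 0 < 1 - 6 / t by linarith)
    rw [neg_div, ← sub_eq_add_neg]
    refine le_trans ?_ h2
    have h3 : (1 - 6 / t)⁻¹ ≤ 1 + 2 * (6 / t) := by
      rw [inv_le_iff_one_le_mul₀ (by linarith)]
      nlinarith
    have h4 : 2 * (6 / t) = 12 / t := by ring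
    linarith
  push_cast
  have : 12 * ((s : ℝ) + 1) / t = 12 * s / t + 12 / t := by ring
  linarith

theorem le_of_bookPotential_le {r t p B : ℝ} {s : ℕ} (hp : r < p) (ht : 0 < t)
    (h : bookPotential r t p s ≤ B) : 2 * Real.exp (-B) ≤ p - r := by
  have h0 : 0 < p - r := by linarith
  have h1 : Real.log (2 / (p - r)) ≤ B := by
    have : (0 : ℝ) ≤ 12 * s / t := by positivity
    unfold bookPotential at h
    linarith
  rw [Real.log_le_iff_le_exp (by positivity), div_le_iff₀ h0] at h1
  rw [Real.exp_neg, ← div_eq_mul_inv, div_le_iff₀ (Real.exp_pos _)]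
  linarith

open Finset Classical in
theorem card_le_card_neighbours {V : Type u} {H : Bool → SimpleGraph V}
    (hH : ∀ x y, x ≠ y → (H true).Adj x y ∨ (H false).Adj x y) (S : Finset V) (x : V) :
    #S ≤ #{v ∈ S | (H true).Adj x v} + #{v ∈ S | (H false).Adj x v} + 1 := by
  have h1 : S ⊆ ({v ∈ S | (H true).Adj x v} ∪ {v ∈ S | (H false).Adj x v}) ∪ {x} := by
    intro v hv
    simp only [mem_union, mem_filter, mem_singleton]
    by_cases hxv : v = x
    · exact Or.inr hxv
    · rcases hH x v (Ne.symm hxv) with h | h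
      · exact Or.inl (Or.inl ⟨hv, h⟩)
      · exact Or.inl (Or.inr ⟨hv, h⟩)
  refine (card_le_card h1).trans ((card_union_le _ _).trans ?_)
  rw [card_singleton]
  exact Nat.add_le_add_right (card_union_le _ _) 1

-- A colour step lowers one `s c` by one and a boost step lowers one potential by at least `η`. So
-- `s c + potential / η` bounds the steps left in colour `c`, each of which keeps at least a
-- proportion `r c` of `Y c`, and the sum over both colours is the induction measure. The reservoir
-- pays `A` for a colour step and `κ` per unit of potential for a boost step.
set_option maxHeartbeats 1600000 in
open Finset Classical in
theorem exists_book_of_potential {V : Type u} (H : Bool → SimpleGraph V)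
    (hH : ∀ x y, x ≠ y → (H true).Adj x y ∨ (H false).Adj x y)
    (r m : Bool → ℝ) (hr : ∀ c, 0 < r c) (hm : ∀ c, 0 < m c)
    (t η κ A B : ℝ) (j₀ : ℕ) (ht : 12 ≤ t) (hη : 0 < η)
    (hηle : η ≤ Real.log (1 + ((j₀ : ℝ) ^ 2 - 6) / t)) (hj₀ : 6 ≤ (j₀ : ℝ) ^ 2)
    (hA : 4000 * Real.exp (3 * j₀) ≤ Real.exp A) (hκ : 0 ≤ κ)
    (hboost : ∀ j : ℕ, j₀ ≤ j → ((j : ℝ) ^ 2 - 6) / t ≤ Real.exp B / 2 →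
      3 * j + Real.log 1000 ≤ κ * Real.log (1 + ((j : ℝ) ^ 2 - 6) / t)) :
    ∀ (n : ℕ) (X : Finset V) (Y : Bool → Finset V) (p : Bool → ℝ) (s : Bool → ℕ),
      (∀ c, r c < p c) → (∀ c, bookPotential (r c) t (p c) (s c) ≤ B) →
      Real.exp (A * (s true + s false) + κ * (bookPotential (r true) t (p true) (s true) +
        bookPotential (r false) t (p false) (s false))) ≤ #X →
      (∀ c, m c * Real.exp (-Real.log (r c) *
        (s c + bookPotential (r c) t (p c) (s c) / η)) ≤ #(Y c)) →
      (∀ c, ∀ x ∈ X, p c * #(Y c) ≤ #{v ∈ Y c | (H c).Adj x v}) →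
      ((s true + bookPotential (r true) t (p true) (s true) / η) +
        (s false + bookPotential (r false) t (p false) (s false) / η) ≤ n) →
      ∃ c, HasBook (H c) X (Y c) (s c) (m c) := by
  have ht0 : 0 < t := by linarith
  have basic : ∀ (X : Finset V) (Y : Bool → Finset V) (p : Bool → ℝ) (s : Bool → ℕ) (D : ℝ),
      (∀ c, r c < p c) → Real.exp D ≤ #X →
      (∀ c, m c * Real.exp (-Real.log (r c) *
        (s c + bookPotential (r c) t (p c) (s c) / η)) ≤ #(Y c)) →
      (∀ c, ∀ x ∈ X, p c * #(Y c) ≤ #{v ∈ Y c | (H c).Adj x v}) →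
      X.Nonempty ∧ (∀ c, (Y c).Nonempty) ∧ (∀ c, p c ≤ 1) := by
    intro X Y p s D hp hX hY hdeg
    have hXne : X.Nonempty := by
      rw [← card_pos]
      exact_mod_cast (Real.exp_pos _).trans_le hX
    have hYne : ∀ c, (Y c).Nonempty := fun c => by
      rw [← card_pos]
      exact_mod_cast (mul_pos (hm c) (Real.exp_pos _)).trans_le (hY c)
    refine ⟨hXne, hYne, fun c => ?_⟩
    obtain ⟨x, hx⟩ := hXne
    have h1 : (0 : ℝ) < #(Y c) := by exact_mod_cast (hYne c).card_pos
    have h2 : (#{v ∈ Y c | (H c).Adj x v} : ℝ) ≤ #(Y c) := by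
      exact_mod_cast card_filter_le _ _
    have h3 := hdeg c x hx
    by_contra! h4
    nlinarith
  intro n
  induction n with
  | zero =>
    intro X Y p s hp hB hX hY hdeg hn
    obtain ⟨hXne, hYne, hp1⟩ := basic X Y p s _ hp hX hY hdeg
    have hpot : ∀ c, 0 ≤ bookPotential (r c) t (p c) (s c) := fun c =>
      bookPotential_nonneg _ (hr c).le ht0 (hp c) (hp1 c)
    have hs : (s true : ℝ) ≤ 0 := by
      have h1 := div_nonneg (hpot true) hη.le
      have h2 := div_nonneg (hpot false) hη.le
      have h3 : (0 : ℝ) ≤ s false := Nat.cast_nonneg _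
      push_cast at hn
      linarith
    have hs0 : s true = 0 := by exact_mod_cast le_antisymm hs (Nat.cast_nonneg _)
    refine ⟨true, ∅, empty_subset _, Y true, Subset.rfl, by simp [hs0], ?_, by simp, by simp⟩
    refine le_trans (le_mul_of_one_le_right (hm true).le (Real.one_le_exp ?_)) (hY true)
    have h1 := div_nonneg (hpot true) hη.le
    have h2 := Real.log_nonpos (hr true).le ((hp true).le.trans (hp1 true))
    rw [hs0] at h1 ⊢
    simp only [Nat.cast_zero, zero_add]
    exact mul_nonneg (by linarith) h1
  | succ n ih =>
    intro X Y p s hp hB hX hY hdeg hn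
    obtain ⟨hXne, hYne, hp1⟩ := basic X Y p s _ hp hX hY hdeg
    have hpot : ∀ c, 0 ≤ bookPotential (r c) t (p c) (s c) := fun c =>
      bookPotential_nonneg _ (hr c).le ht0 (hp c) (hp1 c)
    have hlogr : ∀ c, 0 ≤ -Real.log (r c) := fun c => by
      linarith [Real.log_nonpos (hr c).le ((hp c).le.trans (hp1 c))]
    by_cases hs0 : ∃ c, s c = 0
    · obtain ⟨c, hc⟩ := hs0
      refine ⟨c, ∅, empty_subset _, Y c, Subset.rfl, by simp [hc], ?_, by simp, by simp⟩
      refine le_trans (le_mul_of_one_le_right (hm c).le (Real.one_le_exp ?_)) (hY c)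
      have h1 := div_nonneg (hpot c) hη.le
      exact mul_nonneg (hlogr c) (by positivity)
    push Not at hs0
    have hp0 : ∀ c, 0 < p c := fun c => (hr c).trans (hp c)
    have hq : ∀ c, 0 < p c - r c := fun c => by linarith [hp c]
    obtain ⟨j, i, x, X', Y', hxX, hX'X, hX'card, hY', hdi, hdni⟩ :=
      exists_book_step H X hXne Y p (fun c => (p c - r c) / t) hYne hp0
        (fun c => div_pos (hq c) ht0) hdeg
    have hY'card : ∀ c, ∀ E : ℝ, m c * Real.exp (-Real.log (r c) * (E + 1)) ≤ #(Y c) →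
        m c * Real.exp (-Real.log (r c) * E) ≤ #(Y' c) := by
      intro c E hE
      have h1 : m c * Real.exp (-Real.log (r c) * E) =
          r c * (m c * Real.exp (-Real.log (r c) * (E + 1))) := by
        have h2 : -Real.log (r c) * (E + 1) = -Real.log (r c) * E + -Real.log (r c) := by ring
        rw [h2, Real.exp_add, Real.exp_neg (Real.log (r c)), Real.exp_log (hr c)]
        have := (hr c).ne'
        field_simp
      rw [h1]
      calc _ ≤ r c * (#(Y c) : ℝ) := mul_le_mul_of_nonneg_left hE (hr c).le
        _ ≤ p c * #(Y c) := mul_le_mul_of_nonneg_right (hp c).le (Nat.cast_nonneg _)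
        _ ≤ _ := (hY' c).2.2
    -- Small `j` is a colour step: `x` joins the spine of a colour in which it has enough neighbours
    -- in `X'`, and only that colour changes its page set and density.
    rcases lt_or_ge j j₀ with hj | hj
    · have hdall : ∀ c, ∀ y ∈ X',
          (p c - 6 * ((p c - r c) / t)) * #(Y' c) ≤ #{v ∈ Y' c | (H c).Adj y v} := by
        intro c y hy
        by_cases hc : c = i
        · subst hc
          refine le_trans (mul_le_mul_of_nonneg_right ?_ (Nat.cast_nonneg _)) (hdi y hy)
          have h1 : 0 < (p c - r c) / t := div_pos (hq c) ht0
          nlinarith [sq_nonneg (j : ℝ)]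
        · have hc' : c = !i := Bool.eq_not.mpr hc
          subst hc'
          exact hdni y hy
      have hAj : 4000 * Real.exp (3 * j) ≤ Real.exp A := by
        refine le_trans ?_ hA
        have : (j : ℝ) ≤ j₀ := by exact_mod_cast hj.le
        gcongr
      have hX'A : ∀ D : ℝ, Real.exp (A + D) ≤ #X → 4 * Real.exp D ≤ #X' := by
        intro D hD
        refine le_trans ?_ hX'card
        have h1 : 4000 * Real.exp (3 * j) * Real.exp D ≤ #X := by
          refine le_trans ?_ hD
          rw [Real.exp_add]
          gcongr
        calc 4 * Real.exp D
            = Real.exp (-(3 * j)) / 1000 * (4000 * Real.exp (3 * j) * Real.exp D) := by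
              rw [Real.exp_neg]; field_simp; norm_num
          _ ≤ _ := by gcongr
      have hA0 : 0 ≤ A := by
        rw [← Real.exp_le_exp, Real.exp_zero]
        have := Real.one_le_exp (show (0 : ℝ) ≤ 3 * j by positivity)
        linarith
      have hs1 : ∀ c, 1 ≤ s c := fun c => Nat.one_le_iff_ne_zero.mpr (hs0 c)
      set D : ℝ := A * (s true + s false - 1) + κ * (bookPotential (r true) t (p true) (s true) +
        bookPotential (r false) t (p false) (s false)) with hD
      have hDX' : 4 * Real.exp D ≤ #X' := by
        refine hX'A D (le_of_eq_of_le ?_ hX)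
        rw [hD]; congr 1; ring
      have hD0 : 0 ≤ D := by
        have h1 : (1 : ℝ) ≤ s true := by exact_mod_cast hs1 true
        have h2 : (1 : ℝ) ≤ s false := by exact_mod_cast hs1 false
        have h3 := mul_nonneg hκ (add_nonneg (hpot true) (hpot false))
        have h4 : 0 ≤ A * ((s true : ℝ) + s false - 1) := mul_nonneg hA0 (by linarith)
        linarith
      have hsplit := card_le_card_neighbours hH X' x
      -- The factor `4` leaves room for two colour classes and for `x` itself, since `1 ≤ exp D`.
      have hchoice : ∃ c, Real.exp D ≤ #{v ∈ X' | (H c).Adj x v} := by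
        by_contra! hcon
        have h1 := hcon true
        have h2 := hcon false
        have h3 := Real.one_le_exp hD0
        have h4 : (#X' : ℝ) ≤
            #{v ∈ X' | (H true).Adj x v} + #{v ∈ X' | (H false).Adj x v} + 1 := by
          exact_mod_cast hsplit
        linarith
      obtain ⟨c₀, hc₀⟩ := hchoice
      set Yn : Bool → Finset V := fun c => if c = c₀ then Y' c else Y c with hYn
      set pn : Bool → ℝ := fun c => if c = c₀ then p c - 6 * ((p c - r c) / t) else p c with hpn
      set sn : Bool → ℕ := fun c => if c = c₀ then s c - 1 else s c with hsn
      have hpotn : ∀ c, bookPotential (r c) t (pn c) (sn c) ≤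
          bookPotential (r c) t (p c) (s c) := by
        intro c
        by_cases hc : c = c₀
        · subst hc
          simp only [hpn, hsn, if_true]
          have h1 := bookPotential_colour (s := s c - 1) (hp c) ht
          rwa [Nat.sub_add_cancel (hs1 c)] at h1
        · simp only [hpn, hsn, if_neg hc, le_refl]
      have hsnc : ∀ c, (sn c : ℝ) = s c - if c = c₀ then 1 else 0 := by
        intro c
        by_cases hc : c = c₀
        · simp only [hsn, if_pos hc, Nat.cast_sub (hs1 c), Nat.cast_one]
        · simp only [hsn, if_neg hc, sub_zero]
      have hssum : (sn true : ℝ) + sn false = s true + s false - 1 := by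
        rw [hsnc, hsnc]
        cases c₀ <;> simp <;> ring
      have hres := ih {v ∈ X' | (H c₀).Adj x v} Yn pn sn ?_ ?_ ?_ ?_ ?_ ?_
      · obtain ⟨c, hc⟩ := hres
        refine ⟨c, ?_⟩
        by_cases hcc : c = c₀
        · subst hcc
          simp only [hYn, hsn, if_true] at hc
          have h1 := hc.insert hxX ((filter_subset _ _).trans hX'X) (hY' c).1
            (fun v hv => (mem_filter.mp hv).2) (hY' c).2.1
          rwa [Nat.sub_add_cancel (hs1 c)] at h1
        · simp only [hYn, hsn, if_neg hcc] at hc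
          exact hc.mono ((filter_subset _ _).trans hX'X) Subset.rfl
      · intro c
        simp only [hpn]
        split_ifs
        · have h1 : 6 * ((p c - r c) / t) ≤ (p c - r c) / 2 := by
            rw [← mul_div_assoc, div_le_iff₀ ht0]
            nlinarith [hq c]
          linarith [hq c]
        · exact hp c
      · exact fun c => (hpotn c).trans (hB c)
      · refine le_trans (Real.exp_le_exp.mpr ?_) hc₀
        rw [hssum, hD]
        have h1 := mul_le_mul_of_nonneg_left (add_le_add (hpotn true) (hpotn false)) hκ
        linarith
      · intro c
        have h1 : bookPotential (r c) t (pn c) (sn c) / η ≤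
            bookPotential (r c) t (p c) (s c) / η := div_le_div_of_nonneg_right (hpotn c) hη.le
        by_cases hc : c = c₀
        · simp only [hYn, if_pos hc]
          apply hY'card
          refine le_trans ?_ (hY c)
          refine mul_le_mul_of_nonneg_left (Real.exp_le_exp.mpr ?_) (hm c).le
          refine mul_le_mul_of_nonneg_left ?_ (hlogr c)
          rw [hsnc, if_pos hc]
          linarith
        · simp only [hYn, if_neg hc]
          refine le_trans ?_ (hY c)
          refine mul_le_mul_of_nonneg_left (Real.exp_le_exp.mpr ?_) (hm c).le
          refine mul_le_mul_of_nonneg_left ?_ (hlogr c)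
          rw [hsnc, if_neg hc]
          linarith
      · intro c y hy
        have hy := (mem_filter.mp hy).1
        by_cases hc : c = c₀
        · simp only [hYn, hpn, if_pos hc]
          exact hdall c y hy
        · simp only [hYn, hpn, if_neg hc]
          exact hdeg c y (hX'X hy)
      · have h1 : bookPotential (r true) t (pn true) (sn true) / η ≤
            bookPotential (r true) t (p true) (s true) / η :=
          div_le_div_of_nonneg_right (hpotn true) hη.le
        have h2 : bookPotential (r false) t (pn false) (sn false) / η ≤
            bookPotential (r false) t (p false) (s false) / η :=
          div_le_div_of_nonneg_right (hpotn false) hη.le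
        push_cast at hn
        linarith
    -- Large `j` is a boost step: no vertex is added, colour `i` passes to `Y' i` with a higher
    -- density, and the other colour keeps its old page set and density.
    · have hl0 : ((j₀ : ℝ) ^ 2 - 6) / t ≤ ((j : ℝ) ^ 2 - 6) / t := by
        have : (j₀ : ℝ) ≤ j := by exact_mod_cast hj
        gcongr
      have hl00 : 0 ≤ ((j₀ : ℝ) ^ 2 - 6) / t := div_nonneg (by linarith) ht0.le
      set l : ℝ := (j : ℝ) ^ 2 - 6 with hl
      have hl1 : 0 < 1 + l / t := by linarith
      have hlog : η ≤ Real.log (1 + l / t) :=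
        hηle.trans (Real.log_le_log (by linarith) (by linarith))
      have hboostpot := bookPotential_boost (s i) (hp i) hl1
      have hY'i : 0 < (#(Y' i) : ℝ) := by
        refine lt_of_lt_of_le (mul_pos (hp0 i) ?_) (hY' i).2.2
        exact_mod_cast (hYne i).card_pos
      have hX'ne : X'.Nonempty := by
        rw [← card_pos]
        have h1 : (0 : ℝ) < #X := by exact_mod_cast hXne.card_pos
        exact_mod_cast (show (0 : ℝ) < Real.exp (-(3 * j)) / 1000 * #X by positivity).trans_le
          hX'card
      have hpi1 : p i + l * ((p i - r i) / t) ≤ 1 := by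
        obtain ⟨y, hy⟩ := hX'ne
        have h2 : (#{v ∈ Y' i | (H i).Adj y v} : ℝ) ≤ #(Y' i) := by
          exact_mod_cast card_filter_le _ _
        have h3 := hdi y hy
        by_contra! h4
        nlinarith
      -- The new density is at most `1` while the old one has `p - r ≥ 2 exp (-B)`, which bounds the
      -- boost as `hboost` requires.
      have hlB : l / t ≤ Real.exp B / 2 := by
        have h1 := le_of_bookPotential_le (hp i) ht0 (hB i)
        have h2 : (p i - r i) * (l / t) ≤ 1 := by
          have : l * ((p i - r i) / t) = (p i - r i) * (l / t) := by ring
          linarith [hp0 i]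
        have h3 : 0 ≤ l / t := by linarith
        have h4 : 2 * Real.exp (-B) * (l / t) ≤ 1 := by nlinarith
        rw [Real.exp_neg] at h4
        have h5 := Real.exp_pos B
        field_simp at h4 ⊢
        linarith
      have hcost := hboost j hj hlB
      set Yn : Bool → Finset V := fun c => if c = i then Y' c else Y c with hYn
      set pn : Bool → ℝ := fun c => if c = i then p c + l * ((p c - r c) / t) else p c with hpn
      have hpotn : ∀ c, bookPotential (r c) t (pn c) (s c) =
          bookPotential (r c) t (p c) (s c) - if c = i then Real.log (1 + l / t) else 0 := by
        intro c
        by_cases hc : c = i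
        · subst hc; simp only [hpn, if_true]; exact hboostpot
        · simp only [hpn, if_neg hc, sub_zero]
      have hpotsum : bookPotential (r true) t (pn true) (s true) +
          bookPotential (r false) t (pn false) (s false) =
          bookPotential (r true) t (p true) (s true) +
          bookPotential (r false) t (p false) (s false) - Real.log (1 + l / t) := by
        rw [hpotn, hpotn]
        cases i <;> simp <;> ring
      have hlogpos : 0 < Real.log (1 + l / t) := hη.trans_le hlog
      have hres := ih X' Yn pn s ?_ ?_ ?_ ?_ ?_ ?_
      · obtain ⟨c, hc⟩ := hres
        refine ⟨c, hc.mono hX'X ?_⟩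
        simp only [hYn]
        split_ifs
        · exact (hY' c).1
        · exact Subset.rfl
      · intro c
        simp only [hpn]
        split_ifs with hc
        · have h1 : p c + l * ((p c - r c) / t) - r c = (p c - r c) * (1 + l / t) := by ring
          have h2 := mul_pos (hq c) hl1
          linarith
        · exact hp c
      · intro c
        rw [hpotn]
        split_ifs
        · linarith [hB c]
        · linarith [hB c]
      · rw [hpotsum]
        refine le_trans ?_ hX'card
        have h1 : Real.exp (-(3 * j)) / 1000 = Real.exp (-(3 * j) - Real.log 1000) := by
          rw [Real.exp_sub, Real.exp_log (by norm_num)]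
        rw [h1]
        refine le_trans ?_ (mul_le_mul_of_nonneg_left hX (Real.exp_pos _).le)
        rw [← Real.exp_add, Real.exp_le_exp]
        nlinarith
      · intro c
        rw [hpotn]
        by_cases hc : c = i
        · subst hc
          simp only [hYn, if_true]
          apply hY'card
          refine le_trans ?_ (hY c)
          refine mul_le_mul_of_nonneg_left (Real.exp_le_exp.mpr ?_) (hm c).le
          refine mul_le_mul_of_nonneg_left ?_ (hlogr c)
          have h1 : 1 ≤ Real.log (1 + l / t) / η := by rwa [one_le_div hη]
          rw [sub_div]
          linarith
        · simp only [hYn, if_neg hc, sub_zero]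
          exact hY c
      · intro c y hy
        by_cases hc : c = i
        · subst hc
          simp only [hYn, hpn, if_true]
          exact hdi y hy
        · simp only [hYn, hpn, if_neg hc]
          exact hdeg c y (hX'X hy)
      · have h1 : 1 ≤ Real.log (1 + l / t) / η := by rwa [one_le_div hη]
        have h2 := congrArg (fun z => z / η) hpotsum
        simp only [add_div, sub_div] at h2
        push_cast at hn
        linarith

/-! ### Choice of parameters and the book theorem. -/

theorem half_le_log_one_add {x : ℝ} (h0 : 0 ≤ x) (h1 : x ≤ 1) : x / 2 ≤ Real.log (1 + x) := by
  refine le_trans ?_ (Real.le_log_one_add_of_nonneg h0)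
  rw [div_le_div_iff₀ (by norm_num) (by linarith)]
  nlinarith

theorem log_thousand_le : Real.log 1000 ≤ 7 := by
  rw [Real.log_le_iff_le_exp (by norm_num)]
  have h : Real.exp 7 = Real.exp 1 ^ 7 := by rw [← Real.exp_nat_mul]; norm_num
  rw [h]
  calc (1000 : ℝ) ≤ 2.7 ^ 7 := by norm_num
    _ ≤ Real.exp 1 ^ 7 := by
      gcongr
      linarith [Real.exp_one_gt_d9]

theorem four_thousand_le_exp : 4000 ≤ Real.exp 9 := by
  have h : Real.exp 9 = Real.exp 1 ^ 9 := by rw [← Real.exp_nat_mul]; norm_num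
  rw [h]
  calc (4000 : ℝ) ≤ 2.7 ^ 9 := by norm_num
    _ ≤ Real.exp 1 ^ 9 := by
      gcongr
      linarith [Real.exp_one_gt_d9]

/-- Choice of the parameters of the book algorithm. -/
theorem exists_book_parameters {e : ℝ} (he : 0 < e) (he1 : e ≤ 1 / 2) :
    ∃ (γ : ℝ) (j₀ : ℕ), 0 < γ ∧ 36 * γ ≤ e ∧ 12 ≤ (j₀ : ℝ) ^ 2 ∧
      0 ≤ Real.log (2048 / (γ * e ^ 2)) + 12 ∧
      1024 * Real.log (2 / e) * (Real.log (2048 / (γ * e ^ 2)) + 12) ≤ γ * e * j₀ ^ 2 ∧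
      γ * (6 * j₀ + 18 + 80 * (Real.log (2048 / (γ * e ^ 2)) + 12) / j₀) ≤ e / 2 := by
  -- With `γ = w⁻⁴` and `j₀ = w³` one has `γ j₀² = w²` and `γ j₀ = 1 / w`, while the logarithmic
  -- quantity stays below `w`; large `w` then meets every condition.
  have hev : ∀ᶠ w : ℝ in Filter.atTop,
      Real.log (2048 / e ^ 2) + 4 * Real.log w + 12 ≤ w := by
    have h1 := Real.isLittleO_log_id_atTop.bound (show (0 : ℝ) < 1 / 8 by norm_num)
    filter_upwards [h1, Filter.eventually_ge_atTop (2 * (Real.log (2048 / e ^ 2) + 12)),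
      Filter.eventually_ge_atTop 0] with w hw1 hw2 hw3
    simp only [id, Real.norm_eq_abs, abs_of_nonneg hw3] at hw1
    linarith [le_abs_self (Real.log w)]
  have hevn := tendsto_natCast_atTop_atTop (R := ℝ) |>.eventually (hev.and
    ((Filter.eventually_ge_atTop (208 / e)).and
    ((Filter.eventually_ge_atTop (1024 * Real.log (2 / e) / e)).and
      (Filter.eventually_ge_atTop 2))))
  obtain ⟨w, hw1, hw2, hw3, hw4⟩ := hevn.exists
  set W : ℝ := (w : ℝ) with hW
  have hW0 : 0 < W := by linarith
  rw [div_le_iff₀ he] at hw2 hw3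
  have hB : Real.log (2048 / (1 / W ^ 4 * e ^ 2)) =
      Real.log (2048 / e ^ 2) + 4 * Real.log W := by
    rw [show 2048 / (1 / W ^ 4 * e ^ 2) = 2048 / e ^ 2 * W ^ 4 by field_simp,
      Real.log_mul (by positivity) (by positivity), Real.log_pow]
    norm_num
  have hlogW : 0 ≤ Real.log W := Real.log_nonneg (by linarith)
  have hlog1 : 0 ≤ Real.log (2048 / e ^ 2) := Real.log_nonneg (by
    rw [le_div_iff₀ (by positivity)]; nlinarith)
  have hlog2 : 0 ≤ Real.log (2 / e) := Real.log_nonneg (by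
    rw [le_div_iff₀ (by positivity)]; nlinarith)
  have hW3 : 8 ≤ W ^ 3 := by
    calc (8 : ℝ) = 2 ^ 3 := by norm_num
      _ ≤ W ^ 3 := by gcongr
  have hW4 : W ^ 4 = W * W ^ 3 := by ring
  refine ⟨1 / W ^ 4, w ^ 3, by positivity, ?_, ?_, ?_, ?_, ?_⟩
  · rw [mul_one_div, div_le_iff₀ (by positivity), hW4]
    nlinarith
  · push_cast
    nlinarith
  · rw [hB]; linarith
  · rw [hB]
    push_cast
    rw [← hW]
    have h1 : 1 / W ^ 4 * e * (W ^ 3) ^ 2 = W * e * W := by field_simp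
    rw [h1]
    calc _ ≤ 1024 * Real.log (2 / e) * W := by gcongr
      _ ≤ W * e * W := by gcongr
  · rw [hB]
    push_cast
    rw [← hW]
    set B := Real.log (2048 / e ^ 2) + 4 * Real.log W + 12
    have h1 : 80 * B / W ^ 3 ≤ 80 := by
      rw [div_le_iff₀ (by positivity)]
      have : W ≤ W ^ 3 := le_self_pow₀ (by linarith) (by norm_num)
      linarith
    rw [one_div, inv_mul_le_iff₀ (by positivity)]
    nlinarith

set_option maxHeartbeats 1000000 in
open Finset Classical in
/-- The book theorem: a vertex set whose degrees in colour `c` are at least about `π c` contains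
a monochromatic book with `t` vertices in the spine and almost `π c ^ t` of all vertices as
pages. -/
theorem exists_book {e : ℝ} (he : 0 < e) (he1 : e ≤ 1 / 2) :
    ∃ γ T : ℝ, 0 < γ ∧ 36 * γ ≤ e ∧ ∀ {V : Type u} (H : Bool → SimpleGraph V)
      (_ : ∀ x y, x ≠ y → (H true).Adj x y ∨ (H false).Adj x y) (S : Finset V)
      (π : Bool → ℝ) (n : ℝ) (t : ℕ), (∀ c, e ≤ π c) → T ≤ t → t ≤ γ * n →
      Real.exp (e * n / 2) ≤ #S →
      (∀ c, ∀ x ∈ S, (π c - 3 * (γ ^ 2 * e ^ 2 / 1024)) * #S ≤ #{v ∈ S | (H c).Adj x v}) →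
      ∃ c, HasBook (H c) S S t (#S * Real.exp (t * Real.log (π c) - t * γ * e / 64)) := by
  obtain ⟨γ, j₀, hγ, hγe, hj₀, hB0, hB1, hB2⟩ := exists_book_parameters he he1
  set B : ℝ := Real.log (2048 / (γ * e ^ 2)) + 12 with hB
  -- From `t ≥ j₀² exp B` it follows that even the largest boosts have `j ≤ t / j₀`.
  refine ⟨γ, max 12 (j₀ ^ 2 * Real.exp B), hγ, hγe, ?_⟩
  intro V H hH S π n t hπ htT htn hS hdeg
  set δ : ℝ := γ * e ^ 2 / 1024 with hδ
  have hδ0 : 0 < δ := by positivity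
  have ht12 : (12 : ℝ) ≤ t := (le_max_left _ _).trans htT
  have htj : (j₀ : ℝ) ^ 2 * Real.exp B ≤ t := (le_max_right _ _).trans htT
  have ht0 : (0 : ℝ) < t := by linarith
  have hj₀1 : (1 : ℝ) ≤ j₀ := by
    have : (0 : ℝ) ≤ j₀ := Nat.cast_nonneg _
    nlinarith
  have hexpB : 1 ≤ Real.exp B := Real.one_le_exp hB0
  have htj0 : (j₀ : ℝ) ^ 2 ≤ t := by nlinarith
  set θ : ℝ := γ ^ 2 * e ^ 2 / 1024 with hθ
  have hθδ : 3 * θ ≤ δ := by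
    have : θ = γ * δ := by rw [hθ, hδ]; ring
    rw [this]
    nlinarith
  have hθ0 : 0 < θ := by positivity
  have hδe : 8 * δ ≤ e := by
    rw [hδ]
    nlinarith [mul_pos hγ (mul_pos he he), mul_pos he he]
  -- The floor lies `δ` below the starting density, so the initial potential is `log (2 / δ) + 12 =
  -- B`, while using `r c` instead of `π c` costs little over `t` steps.
  set r : Bool → ℝ := fun c => π c - 3 * θ - δ with hr
  have hrlow : ∀ c, π c - 2 * δ ≤ r c := fun c => by simp only [hr]; linarith
  have hr0 : ∀ c, e / 2 ≤ r c := fun c => by linarith [hrlow c, hπ c]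
  have hSpos : (0 : ℝ) < #S := (Real.exp_pos _).trans_le hS
  have hπ0 : ∀ c, 0 < π c := fun c => he.trans_le (hπ c)
  have hlogr : ∀ c, -Real.log (r c) ≤ -Real.log (π c) + 4 * δ / e := by
    intro c
    have h1 : π c * (1 - 2 * δ / e) ≤ r c := by
      refine le_trans ?_ (hrlow c)
      have h2 : 2 * δ ≤ π c * (2 * δ / e) := by
        have h3 : 2 * δ = e * (2 * δ / e) := by field_simp
        calc 2 * δ = e * (2 * δ / e) := h3
          _ ≤ π c * (2 * δ / e) := mul_le_mul_of_nonneg_right (hπ c) (by positivity)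
      linarith
    have h3 : 2 * δ / e ≤ 1 / 4 := by rw [div_le_iff₀ he]; linarith
    have h4 : Real.log (π c) + Real.log (1 - 2 * δ / e) ≤ Real.log (r c) := by
      rw [← Real.log_mul (hπ0 c).ne' (by linarith)]
      exact Real.log_le_log (mul_pos (hπ0 c) (by linarith)) h1
    have h5 : -(2 * (2 * δ / e)) ≤ Real.log (1 - 2 * δ / e) := by
      have h6 : 0 < 2 * δ / e := by positivity
      refine le_trans ?_ (Real.one_sub_inv_le_log_of_pos (by linarith))
      have h7 : (1 - 2 * δ / e)⁻¹ ≤ 1 + 2 * (2 * δ / e) := by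
        rw [inv_le_iff_one_le_mul₀ (by linarith)]
        nlinarith
      linarith
    have h8 : 2 * (2 * δ / e) = 4 * δ / e := by ring
    linarith
  have hlogr2 : ∀ c, -Real.log (r c) ≤ Real.log (2 / e) := by
    intro c
    rw [← Real.log_inv]
    refine Real.log_le_log (inv_pos.mpr (by linarith [hr0 c])) ?_
    rw [inv_le_comm₀ (by linarith [hr0 c]) (by positivity), inv_div]
    exact hr0 c
  have hpot : ∀ c, bookPotential (r c) t (π c - 3 * θ) t = B := by
    intro c
    have h1 : π c - 3 * θ - r c = δ := by simp only [hr]; ring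
    rw [bookPotential, h1, hB, mul_div_assoc, div_self ht0.ne', mul_one, hδ]
    congr 2
    field_simp
    norm_num
  clear_value B θ δ
  have hl0 : (j₀ : ℝ) ^ 2 / 2 ≤ (j₀ : ℝ) ^ 2 - 6 := by linarith
  have hlpos : 0 < (j₀ : ℝ) ^ 2 - 6 := by linarith
  set η : ℝ := ((j₀ : ℝ) ^ 2 - 6) / t / 2 with hη
  have hη0 : 0 < η := by positivity
  -- The `t` colour steps lose at most `t * γ * e / 256` because `r c` is below `π c`; the at most
  -- `B / η ≤ 4 * t * B / j₀ ^ 2` boost steps lose at most as much again.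
  have hloss : ∀ c, -Real.log (r c) * (t + B / η) ≤
      -(t * Real.log (π c) - t * γ * e / 64) := by
    intro c
    have h1 : B / η ≤ 4 * t * B / j₀ ^ 2 := by
      have h2 : B / η = 2 * t * B / ((j₀ : ℝ) ^ 2 - 6) := by
        rw [hη]; field_simp
      rw [h2, div_le_div_iff₀ hlpos (by positivity)]
      have h3 : 0 ≤ t * B := mul_nonneg ht0.le hB0
      nlinarith
    have h2 : 0 ≤ B / η := div_nonneg hB0 hη0.le
    have h3 : -Real.log (r c) * (B / η) ≤ t * γ * e / 256 := by
      calc _ ≤ Real.log (2 / e) * (B / η) := mul_le_mul_of_nonneg_right (hlogr2 c) h2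
        _ ≤ Real.log (2 / e) * (4 * t * B / j₀ ^ 2) := by
          refine mul_le_mul_of_nonneg_left h1 (Real.log_nonneg ?_)
          rw [le_div_iff₀ he]; linarith
        _ = t * (1024 * Real.log (2 / e) * B) / j₀ ^ 2 / 256 := by ring
        _ ≤ t * (γ * e * j₀ ^ 2) / j₀ ^ 2 / 256 := by gcongr
        _ = t * γ * e / 256 := by field_simp
    have h4 : -Real.log (r c) * t ≤ (-Real.log (π c) + 4 * δ / e) * t :=
      mul_le_mul_of_nonneg_right (hlogr c) ht0.le
    have h5 : 4 * δ / e * t = t * γ * e / 256 := by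
      rw [hδ]; field_simp; norm_num
    have h6 : 0 < t * γ * e := by positivity
    rw [mul_add]
    rw [add_mul, h5] at h4
    linarith
  have hres := exists_book_of_potential H hH r
    (fun c => #S * Real.exp (t * Real.log (π c) - t * γ * e / 64))
    (fun c => by linarith [hr0 c]) (fun c => by positivity) t η (40 * t / j₀) (3 * j₀ + 9) B j₀
    ht12 hη0 (half_le_log_one_add (by positivity) (by rw [div_le_one ht0]; linarith))
    (by linarith) (by rw [Real.exp_add]; nlinarith [four_thousand_le_exp, Real.exp_pos (3 * j₀)])
    (by positivity) ?_
    ⌈(t + B / η) + (t + B / η)⌉₊ S (fun _ => S) (fun c => π c - 3 * θ) (fun _ => t)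
    (fun c => by simp only [hr]; linarith) (fun c => (hpot c).le) ?_ ?_ (fun c => hdeg c) ?_
  · exact hres
  · intro j hj hjB
    have hjj : (j₀ : ℝ) ≤ j := by exact_mod_cast hj
    have h1 : 3 * j + Real.log 1000 ≤ 10 * (j : ℝ) := by linarith [log_thousand_le]
    refine h1.trans ?_
    have hj2 : (j₀ : ℝ) ^ 2 ≤ j ^ 2 := by gcongr
    -- For moderate `j` the logarithm is of order `j² / t`, so cost over gain is of order `t / j ≤ t
    -- / j₀`. For larger `j` the logarithm is at least `1 / 2` and `j ≤ t / j₀`.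
    rcases le_total (((j : ℝ) ^ 2 - 6) / t) 1 with h2 | h2
    · have h3 := half_le_log_one_add (div_nonneg (by linarith) ht0.le) h2
      calc 10 * (j : ℝ) ≤ 40 * t / j₀ * (((j : ℝ) ^ 2 / 2) / t / 2) := by
            have : 40 * t / j₀ * (((j : ℝ) ^ 2 / 2) / t / 2) = 10 * j * (j / j₀) := by
              field_simp; ring
            rw [this]
            exact le_mul_of_one_le_right (by positivity)
              (by rwa [one_le_div (by linarith)])
        _ ≤ 40 * t / j₀ * (((j : ℝ) ^ 2 - 6) / t / 2) := by
            gcongr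
            linarith
        _ ≤ _ := by gcongr
    · have h3 : 1 / 2 ≤ Real.log (1 + ((j : ℝ) ^ 2 - 6) / t) :=
        (half_le_log_one_add zero_le_one le_rfl).trans
          (Real.log_le_log (by norm_num) (by linarith))
      have h4 : (j : ℝ) ^ 2 ≤ t * Real.exp B := by
        rw [div_le_iff₀ ht0] at hjB
        nlinarith
      have h5 : (j : ℝ) ≤ t / j₀ := by
        rw [le_div_iff₀ (by linarith)]
        refine (pow_le_pow_iff_left₀ (by positivity) ht0.le two_ne_zero).mp ?_
        rw [mul_pow]
        calc (j : ℝ) ^ 2 * j₀ ^ 2 ≤ t * Real.exp B * j₀ ^ 2 := by gcongr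
          _ = t * (j₀ ^ 2 * Real.exp B) := by ring
          _ ≤ t * t := by gcongr
          _ = _ := by ring
      calc 10 * (j : ℝ) ≤ 20 * (t / j₀) := by linarith
        _ = 40 * t / j₀ * (1 / 2) := by ring
        _ ≤ _ := by gcongr
  · rw [hpot, hpot]
    refine le_trans (Real.exp_le_exp.mpr ?_) hS
    have h1 : (3 * (j₀ : ℝ) + 9) * (t + t) + 40 * t / j₀ * (B + B) =
        t * (6 * j₀ + 18 + 80 * B / j₀) := by ring
    rw [h1]
    have h2 : 0 ≤ 6 * (j₀ : ℝ) + 18 + 80 * B / j₀ := by positivity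
    have hn : 0 ≤ n := by
      by_contra! hn
      nlinarith
    calc _ ≤ γ * n * (6 * j₀ + 18 + 80 * B / j₀) := by gcongr
      _ = γ * (6 * j₀ + 18 + 80 * B / j₀) * n := by ring
      _ ≤ e / 2 * n := by gcongr
      _ = _ := by ring
  · intro c
    rw [hpot]
    have h1 := Real.exp_le_exp.mpr (hloss c)
    have h2 : Real.exp (t * Real.log (π c) - t * γ * e / 64) *
        Real.exp (-(t * Real.log (π c) - t * γ * e / 64)) = 1 := by
      rw [← Real.exp_add]; simp
    calc _ ≤ #S * Real.exp (t * Real.log (π c) - t * γ * e / 64) *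
          Real.exp (-(t * Real.log (π c) - t * γ * e / 64)) := by gcongr
      _ = #S := by rw [mul_assoc, h2, mul_one]
      _ ≤ _ := le_rfl
  · rw [hpot, hpot]
    exact Nat.le_ceil _

/-! ### Monochromatic cliques, Erdős–Szekeres and binomial estimates. -/

/-- The vertex set `S` contains, for some colour `c`, a clique of colour `c` with `a c + 1`
vertices. -/
def HasMonoClique {V : Type u} (H : Bool → SimpleGraph V) (S : Finset V) (a : Bool → ℕ) : Prop :=
  ∃ c, ∃ s ⊆ S, (H c).IsNClique (a c + 1) s

theorem HasMonoClique.of_join {V : Type u} {H : Bool → SimpleGraph V} {S T M : Finset V}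
    {a : Bool → ℕ} {c : Bool} {t : ℕ} (hT : T ⊆ S) (hM : M ⊆ S) (hcard : T.card = t)
    (hcl : (H c).IsClique (T : Set V)) (hj : ∀ x ∈ T, ∀ y ∈ M, (H c).Adj x y) (ht : t ≤ a c)
    (h : HasMonoClique H M (Function.update a c (a c - t))) : HasMonoClique H S a := by
  classical
  obtain ⟨c', s, hs, hsc⟩ := h
  by_cases hc : c' = c
  · subst hc
    rw [Function.update_self] at hsc
    refine ⟨c', T ∪ s, Finset.union_subset hT (hs.trans hM), ?_, ?_⟩
    · rw [Finset.coe_union]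
      intro x hx y hy hxy
      rcases hx with hx | hx <;> rcases hy with hy | hy
      · exact hcl hx hy hxy
      · exact hj x hx y (hs hy)
      · exact (hj y hy x (hs hx)).symm
      · exact hsc.isClique hx hy hxy
    · rw [Finset.card_union_of_disjoint, hcard, hsc.card_eq]
      · omega
      · refine Finset.disjoint_left.mpr fun x hx hx' => ?_
        exact (H c').loopless.irrefl x (hj x hx x (hs hx'))
  · rw [Function.update_of_ne hc] at hsc
    exact ⟨c', s, hs.trans hM, hsc⟩

open Finset Classical in
theorem HasMonoClique.of_neighbours {V : Type u} {H : Bool → SimpleGraph V} {S : Finset V}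
    {a : Bool → ℕ} {c : Bool} {x : V} (hx : x ∈ S) (ha : 1 ≤ a c)
    (h : HasMonoClique H {v ∈ S | (H c).Adj x v} (Function.update a c (a c - 1))) :
    HasMonoClique H S a :=
  HasMonoClique.of_join (T := {x}) (singleton_subset_iff.mpr hx) (filter_subset _ _)
    (card_singleton x) (by simp)
    (fun y hy v hv => by rw [mem_singleton.mp hy]; exact (mem_filter.mp hv).2) ha h

theorem hasMonoClique_of_eq_zero {V : Type u} (H : Bool → SimpleGraph V) {S : Finset V}
    {a : Bool → ℕ} {c : Bool} (hS : S.Nonempty) (hc : a c = 0) : HasMonoClique H S a := by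
  obtain ⟨x, hx⟩ := hS
  exact ⟨c, {x}, Finset.singleton_subset_iff.mpr hx, by simp [hc]⟩

/-- The Erdős–Szekeres bound as a function of the clique sizes. -/
def esBound (a : Bool → ℕ) : ℕ := (a true + a false).choose (a true)

theorem esBound_eq (a : Bool → ℕ) (c : Bool) : esBound a = (a c + a (!c)).choose (a c) := by
  cases c
  · rw [esBound, add_comm, ← Nat.choose_symm_add]; rfl
  · rfl

theorem esBound_pos (a : Bool → ℕ) : 0 < esBound a := Nat.choose_pos (Nat.le_add_right _ _)

theorem esBound_update (a : Bool → ℕ) (c : Bool) (b : ℕ) :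
    esBound (Function.update a c b) = (b + a (!c)).choose b := by
  rw [esBound_eq _ c, Function.update_self, Function.update_of_ne (by simp)]

theorem esBound_eq_add {a : Bool → ℕ} (h : ∀ c, 1 ≤ a c) :
    esBound a = esBound (Function.update a true (a true - 1)) +
      esBound (Function.update a false (a false - 1)) := by
  obtain ⟨k, hk⟩ := Nat.exists_eq_add_of_le' (h true)
  obtain ⟨l, hl⟩ := Nat.exists_eq_add_of_le' (h false)
  rw [esBound_update, esBound_update, esBound]
  simp only [hk, hl, Bool.not_true, Bool.not_false, Nat.add_sub_cancel]
  rw [show k + 1 + (l + 1) = k + (l + 1) + 1 by ring, Nat.choose_succ_succ]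
  congr 1
  rw [show l + (k + 1) = k + (l + 1) by ring]
  exact Nat.choose_symm_of_eq_add (by omega)

open Finset Classical in
/-- The Erdős–Szekeres theorem. -/
theorem hasMonoClique_of_esBound_le {V : Type u} {H : Bool → SimpleGraph V}
    (hH : ∀ x y, x ≠ y → (H true).Adj x y ∨ (H false).Adj x y) :
    ∀ (n : ℕ) (a : Bool → ℕ), a true + a false = n → ∀ S : Finset V, esBound a ≤ #S →
      HasMonoClique H S a := by
  intro n
  induction n with
  | zero =>
    intro a ha S hS
    exact hasMonoClique_of_eq_zero (c := true) H
      (card_pos.mp ((esBound_pos a).trans_le hS)) (by omega)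
  | succ n ih =>
    intro a ha S hS
    have hSne : S.Nonempty := card_pos.mp ((esBound_pos a).trans_le hS)
    by_cases h0 : ∃ c, a c = 0
    · obtain ⟨c, hc⟩ := h0
      exact hasMonoClique_of_eq_zero H hSne hc
    push Not at h0
    have h1 : ∀ c, 1 ≤ a c := fun c => Nat.one_le_iff_ne_zero.mpr (h0 c)
    obtain ⟨x, hx⟩ := hSne
    have h2 := card_le_card_neighbours hH S x
    rw [esBound_eq_add h1] at hS
    have h3 : ∃ c, esBound (Function.update a c (a c - 1)) ≤ #{v ∈ S | (H c).Adj x v} := by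
      by_contra! hcon
      have := hcon true
      have := hcon false
      omega
    obtain ⟨c, hc⟩ := h3
    refine HasMonoClique.of_neighbours hx (h1 c) (ih _ ?_ _ hc)
    have ht := h1 true
    have hf := h1 false
    cases c <;> simp <;> omega

theorem hasMonoClique_of_hasBook {V : Type u} {H : Bool → SimpleGraph V}
    (hH : ∀ x y, x ≠ y → (H true).Adj x y ∨ (H false).Adj x y) {S : Finset V} {a : Bool → ℕ}
    {c : Bool} {t : ℕ} {m : ℝ} (h : HasBook (H c) S S t m) (ht : t ≤ a c)
    (hm : ((a c - t + a (!c)).choose (a c - t) : ℝ) ≤ m) : HasMonoClique H S a := by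
  obtain ⟨T, hT, M, hM, hcard, hmM, hcl, hj⟩ := h
  refine HasMonoClique.of_join hT hM hcard hcl hj ht
    (hasMonoClique_of_esBound_le hH _ _ rfl M ?_)
  rw [esBound_update]
  exact_mod_cast hm.trans hmM

/-- Since the gain is at most `θ` times either size and `θ < log 2`, this keeps the improved bound
at least `1`, and exponentially large in the balanced range. -/
theorem two_pow_le_choose {k l : ℕ} (h : k ≤ l) : 2 ^ k ≤ (k + l).choose k := by
  induction k with
  | zero => simp
  | succ k ih =>
    have h1 := ih (by omega)
    have h2 := Nat.add_one_mul_choose_eq (k + l) k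
    rw [show k + 1 + l = k + l + 1 by ring]
    refine Nat.le_of_mul_le_mul_right ?_ (Nat.succ_pos k)
    rw [Nat.succ_eq_add_one, ← h2, pow_succ]
    calc 2 ^ k * 2 * (k + 1) = (2 * (k + 1)) * 2 ^ k := by ring
      _ ≤ (k + l + 1) * (k + l).choose k := Nat.mul_le_mul (by omega) h1

/-- Removing `t` vertices from one side gains more than the factor `(k / (k + l)) ^ t`. -/
theorem log_choose_sub_le {e : ℝ} (he0 : 0 ≤ e) (he1 : e ≤ 1) {k l : ℕ}
    (hl : e * (k + l) ≤ l) (t : ℕ) (ht : t ≤ k) :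
    Real.log ((k - t + l).choose (k - t) : ℕ) ≤ Real.log ((k + l).choose k : ℕ) +
      t * Real.log (k / (k + l)) - e * (t * (t - 1)) / (4 * (k + l)) := by
  induction t with
  | zero => simp
  | succ t ih =>
    have h1 := ih (by omega)
    obtain ⟨b, hb⟩ : ∃ b, k = t + 1 + b := ⟨k - (t + 1), by omega⟩
    have hkt : k - t = b + 1 := by omega
    have hkt1 : k - (t + 1) = b := by omega
    rw [hkt] at h1
    rw [hkt1]
    have h2 := Nat.add_one_mul_choose_eq (b + l) b
    rw [show b + l + 1 = b + 1 + l by ring] at h2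
    have hc1 : (0 : ℝ) < ((b + l).choose b : ℕ) := by
      exact_mod_cast Nat.choose_pos (Nat.le_add_right _ _)
    have hc2 : (0 : ℝ) < ((b + 1 + l).choose (b + 1) : ℕ) := by
      exact_mod_cast Nat.choose_pos (Nat.le_add_right _ _)
    have h3 : ((b : ℝ) + 1 + l) * ((b + l).choose b : ℕ) =
        ((b + 1 + l).choose (b + 1) : ℕ) * ((b : ℝ) + 1) := by exact_mod_cast h2
    have hn : (0 : ℝ) < k + l := by rw [hb]; push_cast; positivity
    have hk0 : (0 : ℝ) < k := by rw [hb]; push_cast; positivity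
    have hkb : (k : ℝ) = t + 1 + b := by rw [hb]; push_cast; ring
    have hb0 : (0 : ℝ) ≤ b := Nat.cast_nonneg _
    have ht0 : (0 : ℝ) ≤ t := Nat.cast_nonneg _
    have hl0 : (0 : ℝ) ≤ l := Nat.cast_nonneg _
    have hx0 : 0 ≤ e * t / (k + l) := by positivity
    have hx1 : e * t / (k + l) ≤ 1 := by
      rw [div_le_one hn]
      nlinarith
    have h4 := half_le_log_one_add hx0 hx1
    -- The next removal multiplies the binomial by `(k - t) / (k - t + l)`, below `k / (k + l)` by a
    -- factor of at least `1 + e t / (k + l)`. The logarithms of these factors add up to the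
    -- quadratic saving.
    have h5 : Real.log ((b : ℝ) + 1) + Real.log (1 + e * t / (k + l)) -
        Real.log ((b : ℝ) + 1 + l) ≤ Real.log (k / (k + l)) := by
      rw [← Real.log_mul (by positivity) (by positivity),
        ← Real.log_div (by positivity) (by positivity)]
      refine Real.log_le_log (by positivity) ?_
      have h8 : ((b : ℝ) + 1) * (1 + e * t / (k + l)) * (k + l) =
          (b + 1) * (k + l + e * t) := by field_simp
      rw [div_le_div_iff₀ (by positivity) hn, h8, hkb]
      rw [hkb] at hl
      have h6 : 0 ≤ t * (l - e * (b + 1)) := mul_nonneg ht0 (by nlinarith)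
      nlinarith
    have h6 := congrArg Real.log h3
    rw [Real.log_mul (by positivity) hc1.ne', Real.log_mul hc2.ne' (by positivity)] at h6
    push_cast
    have h7 : e * (((t : ℝ) + 1) * (t + 1 - 1)) / (4 * (k + l)) =
        e * (t * (t - 1)) / (4 * (k + l)) + e * t / (k + l) / 2 := by
      field_simp
      ring
    linarith

/-! ### The exponential improvement by induction. -/

/-- The exponent by which the Erdős–Szekeres bound is improved. -/
noncomputable def ramseyGain (θ e K : ℝ) (a : Bool → ℕ) : ℝ :=
  max 0 (θ * min (a false - e * a true) (a true - e * a false) - K)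

theorem ramseyGain_le {θ e K : ℝ} (hθ : 0 ≤ θ) (he : 0 ≤ e) (hK : 0 ≤ K) (a : Bool → ℕ)
    (c : Bool) : ramseyGain θ e K a ≤ θ * a c := by
  refine max_le (by positivity) ?_
  have h1 : min ((a false : ℝ) - e * a true) (a true - e * a false) ≤ a c := by
    cases c
    · exact (min_le_left _ _).trans (sub_le_self _ (by positivity))
    · exact (min_le_right _ _).trans (sub_le_self _ (by positivity))
  linarith [mul_le_mul_of_nonneg_left h1 hθ]

/-- Neither entry of the minimum falls by more than `1` when a size drops by one, so passing to a
neighbourhood costs at most `θ`. -/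
theorem ramseyGain_le_update {θ e K : ℝ} (hθ : 0 ≤ θ) (he : 0 ≤ e)
    {a : Bool → ℕ} {c : Bool} (hc : 1 ≤ a c) :
    ramseyGain θ e K a ≤ ramseyGain θ e K (Function.update a c (a c - 1)) + θ := by
  have hcast : ((a c - 1 : ℕ) : ℝ) = a c - 1 := by rw [Nat.cast_sub hc, Nat.cast_one]
  have key : min ((a false : ℝ) - e * a true) (a true - e * a false) ≤
      min ((Function.update a c (a c - 1) false : ℝ) - e * Function.update a c (a c - 1) true)
        (Function.update a c (a c - 1) true - e * Function.update a c (a c - 1) false) + 1 := by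
    rw [← min_add_add_right]
    refine min_le_min ?_ ?_
    · cases c <;> simp [hcast] <;> linarith
    · cases c <;> simp [hcast] <;> linarith
  have h2 := mul_le_mul_of_nonneg_left key hθ
  refine max_le (add_nonneg (le_max_left _ _) hθ) ?_
  refine le_trans ?_ (add_le_add_left (le_max_right _ _) θ)
  linarith

/-- Positive gain forces both sizes to be large and balanced; where the gain is zero, plain
Erdős–Szekeres suffices. -/
theorem le_of_ramseyGain_pos {θ e N : ℝ} {a : Bool → ℕ} (hθ : 0 < θ)
    (h : 0 < ramseyGain θ e (θ * N) a) (c : Bool) : N + e * a (!c) ≤ a c := by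
  have h1 : 0 < θ * min ((a false : ℝ) - e * a true) (a true - e * a false) - θ * N := by
    by_contra! h1
    rw [ramseyGain, max_eq_left h1] at h
    exact lt_irrefl _ h
  have h2 : N < min ((a false : ℝ) - e * a true) (a true - e * a false) := by
    refine lt_of_mul_lt_mul_left ?_ hθ.le
    linarith
  rw [lt_min_iff] at h2
  cases c
  · exact le_sub_iff_add_le.mp h2.1.le
  · exact le_sub_iff_add_le.mp h2.2.le

theorem esBound_update_mul {a : Bool → ℕ} {c : Bool} (hc : 1 ≤ a c) :
    esBound (Function.update a c (a c - 1)) * (a c + a (!c)) = esBound a * a c := by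
  rw [esBound_update, esBound_eq a c]
  obtain ⟨k, hk⟩ := Nat.exists_eq_add_of_le' hc
  rw [hk, Nat.add_sub_cancel, show k + 1 + a (!c) = k + a (!c) + 1 by ring,
    ← Nat.add_one_mul_choose_eq]
  ring

set_option maxHeartbeats 1000000 in
open Finset Classical in
/-- Exponential improvement of the Erdős–Szekeres bound when the ratio of the clique sizes is
bounded away from zero and infinity. -/
theorem exists_gain {e : ℝ} (he : 0 < e) (he1 : e ≤ 1) :
    ∃ θ K : ℝ, 0 < θ ∧ θ ≤ 1 / 10 ∧ 0 ≤ K ∧ ∀ {V : Type u} (H : Bool → SimpleGraph V)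
      (_ : ∀ x y, x ≠ y → (H true).Adj x y ∨ (H false).Adj x y) (n : ℕ) (a : Bool → ℕ)
      (_ : a true + a false = n) (S : Finset V),
      esBound a * Real.exp (-ramseyGain θ e K a) ≤ #S → HasMonoClique H S a := by
  obtain ⟨γ, T, hγ, hγe, hbook⟩ := exists_book.{u} (e := e / 2) (by linarith) (by linarith)
  set b : ℝ := e / 2 with hb
  have hb0 : 0 < b := by linarith
  have hb1 : b ≤ 1 / 2 := by linarith
  set θ : ℝ := γ ^ 2 * b ^ 2 / 1024 with hθ
  have hθ0 : 0 < θ := by positivity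
  have hγ1 : γ ≤ 1 / 72 := by linarith
  have hθ1 : θ ≤ 1 / 10 := by
    have h1 : γ ^ 2 ≤ 1 := by nlinarith
    have h2 : b ^ 2 ≤ 1 := by nlinarith
    have h3 : γ ^ 2 * b ^ 2 ≤ 1 * 1 := mul_le_mul h1 h2 (sq_nonneg _) zero_le_one
    rw [hθ]; linarith
  -- The first term makes `⌊γ m⌋` an admissible spine length; the second gives `1 ≤ θ * #S`.
  set N : ℝ := (max T 0 + 4) / γ + 2 / (b * θ) with hN
  have hN0 : 0 < N := by positivity
  clear_value b θ N
  refine ⟨θ, θ * N, hθ0, hθ1, by positivity, ?_⟩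
  intro V H hH n
  induction n using Nat.strong_induction_on with
  | _ n ih =>
    intro a ha S hS
    have hg0 : 0 ≤ ramseyGain θ e (θ * N) a := le_max_left _ _
    rcases hg0.eq_or_lt with hg | hg
    · rw [← hg, neg_zero, Real.exp_zero, mul_one] at hS
      exact hasMonoClique_of_esBound_le hH n a ha S (by exact_mod_cast hS)
    by_contra hcon
    have hac := le_of_ramseyGain_pos hθ0 hg
    obtain ⟨m, hm⟩ : ∃ m : ℝ, m = n := ⟨n, rfl⟩
    have hsum : ∀ c, (a c : ℝ) + a (!c) = m := by
      intro c
      rw [hm, ← ha]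
      push_cast
      cases c
      · exact add_comm _ _
      · rfl
    have hmN : N ≤ m := by
      have h1 := hac true
      have h2 := hsum true
      have h3 : 0 ≤ e * (a (!true) : ℝ) := by positivity
      have h4 : (0 : ℝ) ≤ a (!true) := Nat.cast_nonneg _
      linarith
    have hm0 : 0 < m := hN0.trans_le hmN
    have hbm : ∀ c, b * m ≤ a c := by
      intro c
      have h1 := hac c
      have h2 := hsum c
      have h3 : (0 : ℝ) ≤ a c := Nat.cast_nonneg _
      rw [← h2, hb]
      nlinarith
    have ha1 : ∀ c, 1 ≤ a c := fun c => by
      have h1 : (0 : ℝ) < a c := (mul_pos hb0 hm0).trans_le (hbm c)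
      exact_mod_cast h1
    have hγm : max T 0 + 4 ≤ γ * m := by
      have h1 : (max T 0 + 4) / γ ≤ m := le_trans (by
        rw [hN]; linarith [show 0 < 2 / (b * θ) by positivity]) hmN
      rw [div_le_iff₀ hγ] at h1
      linarith
    have hθm : 2 ≤ b * θ * m := by
      have h1 : 2 / (b * θ) ≤ m := le_trans (by
        rw [hN]; linarith [show 0 < (max T 0 + 4) / γ by positivity]) hmN
      rw [div_le_iff₀ (by positivity)] at h1
      linarith
    have hgle := ramseyGain_le hθ0.le he.le (mul_pos hθ0 hN0).le a
    have hSexp : Real.exp (b * m / 2) ≤ #S := by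
      obtain ⟨d, hd⟩ : ∃ d, a d ≤ a (!d) := by
        rcases le_total (a true) (a false) with h | h
        · exact ⟨true, h⟩
        · exact ⟨false, h⟩
      have h1 : (2 : ℝ) ^ a d ≤ esBound a := by
        rw [esBound_eq a d]
        exact_mod_cast two_pow_le_choose hd
      refine le_trans ?_ ((mul_le_mul_of_nonneg_right h1 (Real.exp_pos _).le).trans hS)
      have h2 : (2 : ℝ) ^ a d = Real.exp (a d * Real.log 2) := by
        rw [Real.exp_nat_mul, Real.exp_log (by norm_num)]
      rw [h2, ← Real.exp_add, Real.exp_le_exp]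
      have h3 : (0 : ℝ) ≤ a d := Nat.cast_nonneg _
      nlinarith [Real.log_two_gt_d9, hgle d, hbm d]
    have hSθ : 1 ≤ θ * #S := by
      have h1 := Real.add_one_le_exp (b * m / 2)
      have h2 : b * m / 2 ≤ #S := by linarith
      nlinarith
    have hSpos : (0 : ℝ) < #S := (Real.exp_pos _).trans_le hSexp
    -- A vertex of larger degree would give a clique by induction in its neighbourhood: `esBound`
    -- falls by the factor `a c / m`, the gain by at most `θ`, and `exp θ ≤ 1 + 2θ`.
    have hdegle : ∀ c, ∀ x ∈ S, (#{v ∈ S | (H c).Adj x v} : ℝ) ≤ (a c / m + 2 * θ) * #S := by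
      intro c x hx
      by_contra! h
      refine hcon (HasMonoClique.of_neighbours hx (ha1 c) (ih (n - 1) ?_ _ ?_ _ ?_))
      · have := ha1 true; omega
      · have := ha1 true
        have := ha1 false
        cases c <;> simp <;> omega
      · refine le_trans ?_ h.le
        have h1 := ramseyGain_le_update (K := θ * N) hθ0.le he.le (ha1 c)
        have h2 : (esBound (Function.update a c (a c - 1)) : ℝ) = esBound a * (a c / m) := by
          rw [← mul_div_assoc, eq_div_iff hm0.ne', ← hsum c]
          exact_mod_cast esBound_update_mul (ha1 c)
        have h3 : Real.exp θ ≤ 1 + 2 * θ := by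
          have := Real.abs_exp_sub_one_le (x := θ) (by rw [abs_of_pos hθ0]; linarith)
          rw [abs_of_pos hθ0] at this
          linarith [le_abs_self (Real.exp θ - 1)]
        have h4 : (a c : ℝ) / m ≤ 1 := by
          rw [div_le_one hm0, ← hsum c]
          exact le_add_of_nonneg_right (Nat.cast_nonneg _)
        have h5 : (0 : ℝ) ≤ a c / m := by positivity
        calc _ ≤ (esBound a : ℝ) * (a c / m) *
              Real.exp (-ramseyGain θ e (θ * N) a + θ) := by
              rw [h2]
              gcongr
              linarith
          _ = (esBound a * Real.exp (-ramseyGain θ e (θ * N) a)) * (a c / m * Real.exp θ) := by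
              rw [Real.exp_add]; ring
          _ ≤ #S * (a c / m * (1 + 2 * θ)) := by gcongr
          _ ≤ #S * (a c / m + 2 * θ) := by
              gcongr
              nlinarith
          _ = _ := mul_comm _ _
    set t : ℕ := ⌊γ * m⌋₊ with ht
    have htle : (t : ℝ) ≤ γ * m := Nat.floor_le (by positivity)
    have hlt : γ * m < t + 1 := Nat.lt_floor_add_one _
    have hT0 := le_max_right T 0
    have hTT := le_max_left T 0
    -- Complement of the bound for the other colour; the third `θ` absorbs `x` itself.
    have hdeg : ∀ c, ∀ x ∈ S, (a c / m - 3 * θ) * #S ≤ (#{v ∈ S | (H c).Adj x v} : ℝ) := by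
      intro c x hx
      have h1 := hdegle (!c) x hx
      have h2 : (#S : ℝ) ≤ #{v ∈ S | (H c).Adj x v} + #{v ∈ S | (H (!c)).Adj x v} + 1 := by
        have h3 := card_le_card_neighbours hH S x
        cases c
        · rw [add_comm (#{v ∈ S | (H true).Adj x v})] at h3
          exact_mod_cast h3
        · exact_mod_cast h3
      have h3 : (a (!c) : ℝ) / m = 1 - a c / m := by
        rw [eq_sub_iff_add_eq, ← add_div, add_comm, hsum c, div_self hm0.ne']
      rw [h3] at h1
      linarith
    obtain ⟨c, hc⟩ := hbook H hH S (fun c => a c / m) m t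
      (fun c => by rw [le_div_iff₀ hm0]; exact hbm c) (by linarith) htle hSexp
      hdeg
    refine hcon (hasMonoClique_of_hasBook hH hc ?_ ?_)
    · have h1 : (t : ℝ) ≤ a c := by
        refine htle.trans (le_trans ?_ (hbm c))
        gcongr
        linarith
      exact_mod_cast h1
    · have htac : t ≤ a c := by
        have h1 : (t : ℝ) ≤ a c := by
          refine htle.trans (le_trans ?_ (hbm c))
          gcongr
          linarith
        exact_mod_cast h1
      have h1 := log_choose_sub_le hb0.le (by linarith) (k := a c) (l := a (!c))
        (by rw [hsum c]; exact hbm _) t htac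
      rw [hsum c, ← esBound_eq] at h1
      have hes : (0 : ℝ) < esBound a := by exact_mod_cast esBound_pos a
      have hch : (0 : ℝ) < ((a c - t + a (!c)).choose (a c - t) : ℕ) := by
        exact_mod_cast Nat.choose_pos (Nat.le_add_right _ _)
      rw [← Real.log_le_log_iff hch (by positivity), Real.log_mul hSpos.ne'
        (Real.exp_pos _).ne', Real.log_exp]
      have h2 := Real.log_le_log (by positivity) hS
      rw [Real.log_mul hes.ne' (Real.exp_pos _).ne', Real.log_exp] at h2
      have ht0 : (0 : ℝ) < t := by linarith
      -- The balance: the binomial saves `t * γ * b / 16`, against `t * γ * b / 64` lost in the book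
      -- and at most `t * γ * b / 512` for the gain.
      have h3 : t * γ * b / 16 ≤ b * (t * (t - 1)) / (4 * m) := by
        rw [div_le_div_iff₀ (by norm_num) (by positivity)]
        have h4 : γ * m / 4 ≤ t - 1 := by linarith
        have h5 : 0 < b * t := by positivity
        nlinarith
      have h4 : ramseyGain θ e (θ * N) a ≤ t * γ * b / 512 := by
        have h5 : (a c : ℝ) ≤ m := by
          rw [← hsum c]; exact le_add_of_nonneg_right (Nat.cast_nonneg _)
        calc _ ≤ θ * a c := hgle c
          _ ≤ θ * m := by gcongr
          _ = (γ * m) * (γ * b ^ 2) / 1024 := by rw [hθ]; ring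
          _ ≤ (2 * t) * (γ * b) / 1024 := by
            have h6 : γ * m ≤ 2 * t := by linarith
            have h7 : γ * b ^ 2 ≤ γ * b := by nlinarith [mul_pos hγ hb0]
            have h8 := mul_le_mul h6 h7 (by positivity) (by positivity)
            linarith
          _ = _ := by ring
      have h5 : 0 < t * γ * b := by positivity
      linarith

/-- Ensures that rounding the bound up to an integer costs at most a factor `2`. -/
theorem one_le_esBound_mul_exp {θ e K : ℝ} (hθ : 0 ≤ θ) (hθ1 : θ ≤ 1 / 10) (he : 0 ≤ e)
    (hK : 0 ≤ K) (a : Bool → ℕ) : 1 ≤ esBound a * Real.exp (-ramseyGain θ e K a) := by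
  obtain ⟨d, hd⟩ : ∃ d, a d ≤ a (!d) := by
    rcases le_total (a true) (a false) with h | h
    · exact ⟨true, h⟩
    · exact ⟨false, h⟩
  have h1 : (2 : ℝ) ^ a d ≤ esBound a := by
    rw [esBound_eq a d]
    exact_mod_cast two_pow_le_choose hd
  refine le_trans ?_ (mul_le_mul_of_nonneg_right h1 (Real.exp_pos _).le)
  have h2 : (2 : ℝ) ^ a d = Real.exp (a d * Real.log 2) := by
    rw [Real.exp_nat_mul, Real.exp_log (by norm_num)]
  rw [h2, ← Real.exp_add]
  refine Real.one_le_exp ?_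
  have h3 : (0 : ℝ) ≤ a d := Nat.cast_nonneg _
  nlinarith [Real.log_two_gt_d9, ramseyGain_le hθ he hK a d]

/-! ### Transfer to Ramsey numbers. -/

theorem isRamsey_of_hasMonoClique {k l n : ℕ}
    (h : ∀ G : SimpleGraph (Fin n), HasMonoClique (fun c => bif c then G else Gᶜ) Finset.univ
      (fun c => bif c then k else l)) : IsRamsey (k + 1) (l + 1) n := by
  intro G
  obtain ⟨c, s, -, hs⟩ := h G
  cases c
  · exact Or.inr ⟨s, by simpa only [cond_false, SimpleGraph.isNClique_compl] using hs⟩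
  · exact Or.inl ⟨s, hs⟩

theorem exists_ramseyNumber_le {e : ℝ} (he : 0 < e) (he1 : e ≤ 1) :
    ∃ θ K : ℝ, 0 < θ ∧ 0 ≤ K ∧ ∀ k l : ℕ, (ramseyNumber (k + 1) (l + 1) : ℝ) ≤
      2 * ((k + l).choose k * Real.exp (-max 0 (θ * min (l - e * k) (k - e * l) - K))) := by
  obtain ⟨θ, K, hθ, hθ1, hK, hgain⟩ := exists_gain.{0} he he1
  refine ⟨θ, K, hθ, hK, fun k l => ?_⟩
  have hone := one_le_esBound_mul_exp hθ.le hθ1 he.le hK (fun c => bif c then k else l)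
  set F : ℝ := esBound (fun c => bif c then k else l) *
    Real.exp (-ramseyGain θ e K (fun c => bif c then k else l)) with hF
  have hceil : (0 : ℝ) < ⌈F⌉₊ := by linarith [Nat.le_ceil F]
  have hle : ramseyNumber (k + 1) (l + 1) ≤ ⌈F⌉₊ := by
    refine (ramseyNumber_isLeast _ _).2 ⟨by exact_mod_cast hceil, ?_⟩
    refine isRamsey_of_hasMonoClique fun G => hgain _ ?_ _ _ rfl _ ?_
    · intro x y hxy
      by_cases h : G.Adj x y
      · exact Or.inl h
      · exact Or.inr ((SimpleGraph.compl_adj _ _ _).mpr ⟨hxy, h⟩)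
    · rw [Finset.card_univ, Fintype.card_fin]
      exact Nat.le_ceil _
  have h1 : (ramseyNumber (k + 1) (l + 1) : ℝ) ≤ ⌈F⌉₊ := by exact_mod_cast hle
  have h2 := Nat.ceil_lt_add_one (show 0 ≤ F by linarith)
  have h3 : F = (k + l).choose k * Real.exp (-max 0 (θ * min (l - e * k) (k - e * l) - K)) := rfl
  rw [← h3]
  linarith

/-! ### Comparison of the exponential gain with `ρ`. -/

theorem ramseyTau_le_one {x : ℝ} (hx : x ≤ 1) : ramseyTau x ≤ 1 := by
  have h : 1 - ramseyTau x = (1 - x) ^ 3 * (6 * x ^ 2 + 3 * x + 1) := by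
    unfold ramseyTau; ring
  have h1 : 0 ≤ (1 - x) ^ 3 * (6 * x ^ 2 + 3 * x + 1) :=
    mul_nonneg (pow_nonneg (by linarith) 3) (by nlinarith [sq_nonneg (4 * x + 1)])
  linarith

theorem ramseyRhoUnit_le {r ε x : ℝ} (hr : 4 ≤ r) (hε : ε < 1) (hx : x ≤ 1) :
    ramseyRhoUnit r ε x ≤ r / 4 := by
  unfold ramseyRhoUnit
  split_ifs
  · linarith
  · have h : (x - ε) / (1 - ε) ≤ 1 := by
      rw [div_le_one (by linarith)]; linarith
    have h1 := ramseyTau_le_one h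
    nlinarith

/-- Either `ρ` vanishes, or it is at most `r / 4` and both ratios of `k` and `l` exceed `ε`. -/
theorem ramseyRho_le {r ε : ℝ} (hr : 4 ≤ r) (hε0 : 0 < ε) (hε : ε < 1) {k l : ℝ} (hk : 0 < k) :
    ramseyRho r ε (l / k) = 0 ∨
      (ramseyRho r ε (l / k) ≤ r / 4 ∧ ε * k ≤ l ∧ ε * l ≤ k) := by
  unfold ramseyRho
  split_ifs with h
  · by_cases h1 : l / k ≤ ε
    · left; simp [ramseyRhoUnit, h1]
    · right
      rw [div_le_one hk] at h
      rw [not_le, lt_div_iff₀ hk] at h1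
      exact ⟨ramseyRhoUnit_le hr hε (by rwa [div_le_one hk]), h1.le, by nlinarith⟩
  · rw [not_le, one_lt_div hk] at h
    rw [one_div_div]
    by_cases h1 : k / l ≤ ε
    · left; simp [ramseyRhoUnit, h1]
    · right
      have hl0 : 0 < l := hk.trans h
      rw [not_le, lt_div_iff₀ hl0] at h1
      exact ⟨ramseyRhoUnit_le hr hε (by rw [div_le_one hl0]; exact h.le), by nlinarith, h1.le⟩

theorem log_sq_le {x : ℝ} (hx : 1 ≤ x) : Real.log x ^ 2 ≤ 4 * x := by
  have h1 : Real.log x ≤ 2 * Real.sqrt x := by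
    have h2 := Real.log_le_sub_one_of_pos (Real.sqrt_pos.mpr (zero_lt_one.trans_le hx))
    rw [Real.log_sqrt (by linarith)] at h2
    linarith
  calc Real.log x ^ 2 ≤ (2 * Real.sqrt x) ^ 2 := by
        have := Real.log_nonneg hx
        gcongr
    _ = 4 * x := by rw [mul_pow, Real.sq_sqrt (by linarith)]; norm_num

theorem mainTheorem4 (ε : ℝ) (hε0 : 0 < ε) (hε : ε < 1 / 2) :
    ∃ C : ℝ, 0 < C ∧
      ∀ r : ℝ, 5 ≤ r → ∀ k l : ℕ, 0 < k →
        (ramseyNumber (k + 1) (l + 1) : ℝ) ≤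
          (2 : ℝ) ^ (C * r ^ 2) * Real.exp (-ramseyPhi r ε k l) * ((k + l).choose k : ℝ) := by
  -- Taking `ε / 2` rather than `ε` leaves a gain linear in `k + l` throughout the range where `ρ`
  -- is nonzero.
  obtain ⟨θ, K, hθ, hK, hR⟩ := exists_ramseyNumber_le (e := ε / 2) (by linarith) (by linarith)
  -- In the constant, `4 + K` absorbs `log 2` and the offset `K`, and `1 / (θ * ε)` makes `L ^ 2 /
  -- (16 * C)` smaller than the linear gain.
  have hC0 : 0 < 4 + K + 1 / (θ * ε) := by positivity
  refine ⟨4 + K + 1 / (θ * ε), hC0, fun r hr k l hk => ?_⟩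
  have hCθ : 1 ≤ (4 + K + 1 / (θ * ε)) * (θ * ε) := by
    have h1 : 1 / (θ * ε) * (θ * ε) = 1 := by field_simp
    have h2 : 0 ≤ (4 + K) * (θ * ε) := by positivity
    rw [add_mul]
    linarith
  have hCK : 4 + K ≤ 4 + K + 1 / (θ * ε) := le_add_of_nonneg_right (by positivity)
  generalize 4 + K + 1 / (θ * ε) = C at hC0 hCθ hCK ⊢
  have hk0 : (0 : ℝ) < k := by exact_mod_cast hk
  have hk1 : (1 : ℝ) ≤ k := by exact_mod_cast hk
  have hl0 : (0 : ℝ) ≤ l := Nat.cast_nonneg l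
  refine (hR k l).trans ?_
  set g : ℝ := max 0 (θ * min ((l : ℝ) - ε / 2 * k) (k - ε / 2 * l) - K) with hg
  have hg0 : 0 ≤ g := le_max_left _ _
  have hr2 : 25 ≤ r ^ 2 := by nlinarith
  have hlog2 := Real.log_two_gt_d9
  have key : Real.log 2 - g ≤ Real.log 2 * (C * r ^ 2) - ramseyPhi r ε k l := by
    have hCr : 1 / 2 * (C * r ^ 2) ≤ Real.log 2 * (C * r ^ 2) :=
      mul_le_mul_of_nonneg_right (by linarith) (by positivity)
    have hlog2' : Real.log 2 ≤ 1 := by linarith [Real.log_two_lt_d9]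
    have hCr2 : 25 * (4 + K) ≤ C * r ^ 2 := by
      calc 25 * (4 + K) ≤ C * 25 := by linarith
        _ ≤ C * r ^ 2 := by gcongr
    rcases ramseyRho_le (r := r) (by linarith) hε0 (by linarith) hk0 with h | ⟨h, h1, h2⟩
    · rw [ramseyPhi, h, zero_mul]
      linarith
    · have hL0 : 0 ≤ Real.log ((k : ℝ) + l) := Real.log_nonneg (by linarith)
      have hL := log_sq_le (show 1 ≤ (k : ℝ) + l by linarith)
      have hphi : ramseyPhi r ε k l ≤ r / 4 * Real.log ((k : ℝ) + l) :=
        mul_le_mul_of_nonneg_right h hL0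
      generalize Real.log ((k : ℝ) + l) = L at hL0 hL hphi
      -- AM-GM uses half of the available `C * r ^ 2 / 2`; the remaining `L ^ 2` term is linear in
      -- `k + l` because `L ^ 2 ≤ 4 * (k + l)`.
      have hamgm : r / 4 * L ≤ C / 4 * r ^ 2 + L ^ 2 / (16 * C) := by
        have h3 : C / 4 * r ^ 2 + L ^ 2 / (16 * C) - r / 4 * L =
            (2 * C * r - L) ^ 2 / (16 * C) := by
          field_simp; ring
        have h4 : 0 ≤ (2 * C * r - L) ^ 2 / (16 * C) := by positivity
        linarith
      have hL2 : L ^ 2 / (16 * C) ≤ θ * (ε / 4 * (k + l)) := by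
        rw [div_le_iff₀ (by positivity)]
        have h3 : 0 ≤ (C * (θ * ε) - 1) * ((k : ℝ) + l) :=
          mul_nonneg (by linarith) (by linarith)
        nlinarith
      have hmin : ε / 4 * ((k : ℝ) + l) ≤ min ((l : ℝ) - ε / 2 * k) (k - ε / 2 * l) := by
        refine le_min ?_ ?_
        · nlinarith
        · nlinarith
      have hgK : θ * (ε / 4 * (k + l)) - K ≤ g := by
        refine le_trans ?_ (le_max_right _ _)
        linarith [mul_le_mul_of_nonneg_left hmin hθ.le]
      linarith
  have h2 : (2 : ℝ) * Real.exp (-g) = Real.exp (Real.log 2 - g) := by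
    rw [sub_eq_add_neg, Real.exp_add, Real.exp_log (by norm_num)]
  have h3 : (2 : ℝ) ^ (C * r ^ 2) * Real.exp (-ramseyPhi r ε k l) =
      Real.exp (Real.log 2 * (C * r ^ 2) - ramseyPhi r ε k l) := by
    rw [Real.rpow_def_of_pos (by norm_num), sub_eq_add_neg, Real.exp_add]
  rw [h3]
  calc _ = Real.exp (Real.log 2 - g) * ((k + l).choose k : ℝ) := by rw [← h2]; ring
    _ ≤ _ := by gcongr
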